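/- \textbf{Fairness.} Let $1\le N\le 4$ and let the process identifiers be $\mathrm{NonNullPID}=\{p_1,\dots,p_N\}$, each belonging to one user, and $\mathrm{PID}=\mathrm{NonNullPID}\cup\{\mathrm{NULL}\}$. Consider the following CSP processes. \emph{Shared variables.} $\mathrm{OWNER}$ is an atomic variable over $\mathrm{PID}$, initially $\mathrm{NULL}$; $\mathrm{STATE\_VAR}$ interleaves one atomic variable $state.p$ per user $p$, with values WAITING, ENGAGING, SCHEDULED, ACTIVE, initially ACTIVE. An atomic variable with value $val$ always offers to output $val$ (get), to be overwritten (set), and a compare-and-swap $cas.expected.new.b$ with $b=(expected=val)$, which changes the value to $new$ exactly if $b$ is true. \emph{Queue.} $\mathrm{QUEUE\_SPEC}(q)$, initially $q=\langle\rangle$, offers, as long as $\mathrm{length}(q)\le max$ (and otherwise nothing), all events $enqueue.p.v$, $end\_enqueue.p$, $dequeue.p$, $peek.p$, $return.p.v$, which leave $q$ unchanged; $lin\_enqueue.p.v$, which appends $v$ to $q$; $lin\_dequeue.p.h$, which removes the head of $q$; and $lin\_peek.p.h$, which leaves $q$ unchanged; here $h$ is the head of $q$, or $\mathrm{NULL}$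 if $q$ is empty. The bound is any $max\ge N$. The queue is $\mathrm{QUEUE\_SPEC}(\langle\rangle)$ synchronised on all these events with the interleaving over all $p$ of the processes that repeatedly perform one of $enqueue.p?v\to lin\_enqueue.p.v\to end\_enqueue.p$, $\;dequeue.p\to lin\_dequeue.p?v\to return.p.v$, $\;peek.p\to lin\_peek.p?v\to return.p.v$; the events $lin\_dequeue$ and $lin\_peek$ are hidden. \emph{Users.} User $p$ repeats $\mathrm{CLAIM}(p);\mathrm{RELEASE}(p)$ forever. $\mathrm{CLAIM}(p)$: $begin\_claim.p$; set $state.p$ to ENGAGING; $enqueue.p.p$; $end\_enqueue.p$; $peek.p$; $return.p?headQ$. Write SUCCEED for: set $state.p$ to ACTIVE, then $end\_claim.p$. Write PARK for: CAS $state.p$ from ENGAGING to WAITING; if this succeeds, wait until $state.p$ can be read as SCHEDULED, set it to ACTIVE, and perform $end\_claim.p$; if it fails, SUCCEED. If $headQ\ne p$, then PARK. If $headQ=p$, CAS the owner from $\mathrm{NULL}$ to $p$; on success SUCCEED; on failure read the owner into $own$. If $own=\mathrm{NULL}$, set the owner to $p$ and SUCCEED. If $own=p$, PARK. Otherwise CAS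 the owner from $own$ to $p$; on success SUCCEED; on failure CAS the owner from $\mathrm{NULL}$ to $p$; on success SUCCEED, on failure PARK. $\mathrm{RELEASE}(p)$: $begin\_release.p$; $dequeue.p$; $return.p.p$; $peek.p$; $return.p?headQ$. If $headQ=\mathrm{NULL}$, CAS the owner from $p$ to $\mathrm{NULL}$ and, whatever the outcome, perform $end\_release.p$. Otherwise CAS the owner from $p$ to $headQ$; on success schedule $headQ$, that is, CAS $state.headQ$ from ENGAGING to SCHEDULED and, if this fails, CAS it from WAITING to SCHEDULED; in every case then perform $end\_release.p$. \emph{Implementation.} $\mathrm{FAIR\_IMPL}$ is the parallel composition of the interleaved users with (queue $|||$ $\mathrm{STATE\_VAR}$ $|||$ $\mathrm{OWNER}$), synchronised on all owner and state events and on $enqueue$, $end\_enqueue$, $dequeue$, $peek$, $return$, with every event hidden except $begin\_claim$, $lin\_enqueue$ and $end\_claim$. \emph{Oracle.} For a set $C$ of identifiers and a sequence $w$ of identifiers, $\mathrm{FAIR}(C,w)$ offers exactly: $begin\_claim.p$ for each $p\notin C$, then behaving as $\mathrm{FAIR}(C\cup\{p\},w)$; $lin\_enqueue.p.p$ for each $p\in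 C$ not occurring in $w$, then behaving as $\mathrm{FAIR}(C,w^\frown\langle p\rangle)$; and, if $w\ne\langle\rangle$, $end\_claim.head(w)$, then behaving as $\mathrm{FAIR}(C\setminus\{head(w)\},tail(w))$. \emph{Claim.} $\mathrm{FAIR}(\emptyset,\langle\rangle)\sqsubseteq_{FD}\mathrm{FAIR\_IMPL}$, i.e. $failures_\bot(\mathrm{FAIR\_IMPL})\subseteq failures_\bot(\mathrm{FAIR}(\emptyset,\langle\rangle))$ and $divergences(\mathrm{FAIR\_IMPL})\subseteq divergences(\mathrm{FAIR}(\emptyset,\langle\rangle))$. Moreover, in every trace of $\mathrm{FAIR\_IMPL}$ (i) the sequence of processes performing $end\_claim$ is a prefix of the sequence of processes performing $lin\_enqueue$ (claims complete exactly in the order in which enqueues committed), and (ii) every $lin\_enqueue.p.v$ has $v=p$, and before it $begin\_claim.p$ has occurred exactly once more often than $lin\_enqueue.p.p$ (only a process that has started claiming, and has not yet enqueued for that claim, can enqueue). -/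

import Mathlib

/-! ## CSP processes and their operational semantics

The usual operators of CSP over an event alphabet `E`, with recursion through process identifiers
`K` (an identifier includes the parameters of the process). -/

inductive Proc (E K : Type) : Type 1
  /-- `STOP` -/
  | STOP : Proc E K
  /-- `SKIP` -/
  | SKIP : Proc E K
  /-- the state reached after successful termination -/
  | omega : Proc E K
  /-- `e → P` -/
  | pre (e : E) (P : Proc E K) : Proc E K
  /-- `P □ Q` -/
  | ext (P Q : Proc E K) : Proc E K
  /-- `□ i : α • P i` -/
  | extAll {α : Type} (P : α → Proc E K) : Proc E K
  /-- `P ; Q` -/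
  | seq (P Q : Proc E K) : Proc E K
  /-- generalised parallel, synchronising on the events of `A` (and on termination) -/
  | par (A : Set E) (P Q : Proc E K) : Proc E K
  /-- `||| i : α • P i` -/
  | interAll {α : Type} (P : α → Proc E K) : Proc E K
  /-- `P \ A` -/
  | hide (P : Proc E K) (A : Set E) : Proc E K
  /-- the process named `k` -/
  | call (k : K) : Proc E K

infixr:60 " ⇾ " => Proc.pre

namespace Proc

/-- `c?x : S → P x` -/
def inputFrom {E K α : Type} (S : Set α) (c : α → E) (P : α → Proc E K) : Proc E K :=
  extAll (fun x : S => c x ⇾ P x)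

/-- `c?x → P x` -/
def input {E K α : Type} (c : α → E) (P : α → Proc E K) : Proc E K :=
  extAll (fun x => c x ⇾ P x)

/-- Interleaving `P ||| Q`. -/
def inter {E K : Type} (P Q : Proc E K) : Proc E K := par ∅ P Q

end Proc

/-- What an observer sees: an event, or the termination signal `✓`. -/
inductive Obs (E : Type) : Type
  | ev (e : E)
  | tick

/-- What a process does: the internal action `τ`, or something observable. -/
inductive Act (E : Type) : Type
  | tau
  | vis (o : Obs E)

namespace Act

abbrev ev {E : Type} (e : E) : Act E := vis (Obs.ev e)

abbrev tick {E : Type} : Act E := vis Obs.tick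

end Act

/-- The transitions of CSP processes; `D k` is the body of the definition of the process `k`. -/
inductive Step {E K : Type} (D : K → Proc E K) : Proc E K → Act E → Proc E K → Prop
  | skip : Step D .SKIP .tick .omega
  | pre (e : E) (P : Proc E K) : Step D (.pre e P) (.ev e) P
  | ext_tau_left {P P' Q : Proc E K} : Step D P .tau P' → Step D (.ext P Q) .tau (.ext P' Q)
  | ext_tau_right {P Q Q' : Proc E K} : Step D Q .tau Q' → Step D (.ext P Q) .tau (.ext P Q')
  | ext_left {P P' Q : Proc E K} {o : Obs E} : Step D P (.vis o) P' →
      Step D (.ext P Q) (.vis o) P'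
  | ext_right {P Q Q' : Proc E K} {o : Obs E} : Step D Q (.vis o) Q' →
      Step D (.ext P Q) (.vis o) Q'
  | extAll_tau {α : Type} {P Q : α → Proc E K} (i : α) : Step D (P i) .tau (Q i) →
      (∀ j, j ≠ i → Q j = P j) → Step D (.extAll P) .tau (.extAll Q)
  | extAll_vis {α : Type} {P : α → Proc E K} {P' : Proc E K} {o : Obs E} (i : α) :
      Step D (P i) (.vis o) P' → Step D (.extAll P) (.vis o) P'
  | seq_left {P P' Q : Proc E K} {a : Act E} : a ≠ .tick → Step D P a P' →
      Step D (.seq P Q) a (.seq P' Q)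
  | seq_tick {P P' Q : Proc E K} : Step D P .tick P' → Step D (.seq P Q) .tau Q
  | par_tau_left {A : Set E} {P P' Q : Proc E K} : Step D P .tau P' →
      Step D (.par A P Q) .tau (.par A P' Q)
  | par_tau_right {A : Set E} {P Q Q' : Proc E K} : Step D Q .tau Q' →
      Step D (.par A P Q) .tau (.par A P Q')
  | par_left {A : Set E} {P P' Q : Proc E K} {e : E} : e ∉ A → Step D P (.ev e) P' →
      Step D (.par A P Q) (.ev e) (.par A P' Q)
  | par_right {A : Set E} {P Q Q' : Proc E K} {e : E} : e ∉ A → Step D Q (.ev e) Q' →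
      Step D (.par A P Q) (.ev e) (.par A P Q')
  | par_sync {A : Set E} {P P' Q Q' : Proc E K} {e : E} : e ∈ A → Step D P (.ev e) P' →
      Step D Q (.ev e) Q' → Step D (.par A P Q) (.ev e) (.par A P' Q')
  | par_tick_left {A : Set E} {P P' Q : Proc E K} : Step D P .tick P' →
      Step D (.par A P Q) .tau (.par A .omega Q)
  | par_tick_right {A : Set E} {P Q Q' : Proc E K} : Step D Q .tick Q' →
      Step D (.par A P Q) .tau (.par A P .omega)
  | par_tick {A : Set E} : Step D (.par A .omega .omega) .tick .omega
  | interAll_step {α : Type} {P Q : α → Proc E K} {a : Act E} (i : α) : a ≠ .tick →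
      Step D (P i) a (Q i) → (∀ j, j ≠ i → Q j = P j) → Step D (.interAll P) a (.interAll Q)
  | interAll_tick_one {α : Type} {P Q : α → Proc E K} {P' : Proc E K} (i : α) :
      Step D (P i) .tick P' → Q i = .omega → (∀ j, j ≠ i → Q j = P j) →
      Step D (.interAll P) .tau (.interAll Q)
  | interAll_tick {α : Type} {P : α → Proc E K} : (∀ i, P i = .omega) →
      Step D (.interAll P) .tick .omega
  | hide_tau {P P' : Proc E K} {A : Set E} : Step D P .tau P' →
      Step D (.hide P A) .tau (.hide P' A)
  | hide_mem {P P' : Proc E K} {A : Set E} {e : E} : e ∈ A → Step D P (.ev e) P' →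
      Step D (.hide P A) .tau (.hide P' A)
  | hide_not_mem {P P' : Proc E K} {A : Set E} {e : E} : e ∉ A → Step D P (.ev e) P' →
      Step D (.hide P A) (.ev e) (.hide P' A)
  | hide_tick {P P' : Proc E K} {A : Set E} : Step D P .tick P' →
      Step D (.hide P A) .tick .omega
  | call {k : K} {a : Act E} {P' : Proc E K} : Step D (D k) a P' → Step D (.call k) a P'

/-! ## The failures/divergences model -/

/-- `Reach D P s Q`: `P` can become `Q` while performing the observable sequence `s`,
with any number of internal actions in between. -/
inductive Reach {E K : Type} (D : K → Proc E K) : Proc E K → List (Obs E) → Proc E K → Prop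
  | refl (P : Proc E K) : Reach D P [] P
  | tau {P Q R : Proc E K} {s : List (Obs E)} : Step D P .tau Q → Reach D Q s R → Reach D P s R
  | vis {P Q R : Proc E K} {o : Obs E} {s : List (Obs E)} :
      Step D P (.vis o) Q → Reach D Q s R → Reach D P (o :: s) R

def traces {E K : Type} (D : K → Proc E K) (P : Proc E K) : Set (List (Obs E)) :=
  {s | ∃ Q, Reach D P s Q}

/-- `P` can perform internal actions for ever. -/
def Diverges {E K : Type} (D : K → Proc E K) (P : Proc E K) : Prop :=
  ∃ f : ℕ → Proc E K, f 0 = P ∧ ∀ i, Step D (f i) .tau (f (i + 1))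

/-- The divergences of `P`: all traces that extend one after which `P` can diverge
(`✓` may only come last in a trace). -/
def divergences {E K : Type} (D : K → Proc E K) (P : Proc E K) : Set (List (Obs E)) :=
  {u | ∃ s t Q, u = s ++ t ∧ Obs.tick ∉ t.dropLast ∧ Reach D P s Q ∧ Diverges D Q}

/-- The state `P` refuses `X`: either it is stable and can do nothing in `X`, or it can terminate
and `✓ ∉ X`. -/
def Refuses {E K : Type} (D : K → Proc E K) (P : Proc E K) (X : Set (Obs E)) : Prop :=
  ((∀ P', ¬ Step D P .tau P') ∧ (∀ P', ¬ Step D P .tick P') ∧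
      ∀ o ∈ X, ∀ P', ¬ Step D P (.vis o) P') ∨
    ((∃ P', Step D P .tick P') ∧ Obs.tick ∉ X)

/-- The stable failures of `P`. -/
def failures {E K : Type} (D : K → Proc E K) (P : Proc E K) :
    Set (List (Obs E) × Set (Obs E)) :=
  {f | ∃ Q, Reach D P f.1 Q ∧ Refuses D Q f.2}

/-- `failures⊥ P`. -/
def failuresBot {E K : Type} (D : K → Proc E K) (P : Proc E K) :
    Set (List (Obs E) × Set (Obs E)) :=
  failures D P ∪ {f | f.1 ∈ divergences D P}

/-- `P ⊑FD Q`: the implementation `Q` refines the specification `P` in the failures/divergences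
model. -/
def FDRefines {E K : Type} (D : K → Proc E K) (P Q : Proc E K) : Prop :=
  failuresBot D Q ⊆ failuresBot D P ∧ divergences D Q ⊆ divergences D P

/-! ## Events and process names of the model with `N` users -/

inductive Operation : Type
  | load
  | store

inductive PState : Type
  | WAITING
  | ENGAGING
  | SCHEDULED
  | ACTIVE

/-- `NonNullPID`; every such identifier belongs to a user. -/
abbrev NonNullPID (N : ℕ) : Type := Fin N

/-- `PID`, where `none` is `NULL`. -/
abbrev PID (N : ℕ) : Type := Option (NonNullPID N)

inductive Event (N : ℕ) : Type
  | owner (op : Operation) (v : PID N)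
  | casOwner (expected newVal : PID N) (succ : Bool)
  | state (op : Operation) (p : NonNullPID N) (v : PState)
  | casState (p : NonNullPID N) (expected newVal : PState) (succ : Bool)
  | enqueue (p v : NonNullPID N)
  | endEnqueue (p : NonNullPID N)
  | dequeue (p : NonNullPID N)
  | peek (p : NonNullPID N)
  | ret (p : NonNullPID N) (v : PID N)
  | linEnqueue (p v : NonNullPID N)
  | linDequeue (p : NonNullPID N) (v : PID N)
  | linPeek (p : NonNullPID N) (v : PID N)
  | beginClaim (p : NonNullPID N)
  | endClaim (p : NonNullPID N)
  | beginRelease (p : NonNullPID N)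
  | endRelease (p : NonNullPID N)

/-- The names of the recursive processes, with their parameters. -/
inductive PName (N : ℕ) : Type
  | ownerVar (v : PID N)
  | stateVar (p : NonNullPID N) (v : PState)
  | queueUser (p : NonNullPID N)
  | queueSpec (q : List (NonNullPID N))
  | user (p : NonNullPID N)
  | fair (claims : Finset (NonNullPID N)) (waiting : List (NonNullPID N))

abbrev CProc (N : ℕ) : Type 1 := Proc (Event N) (PName N)

namespace ClaimRelease

open Proc Event

variable {N : ℕ}

/-! ### Shared variables -/

/-- The body of `ATOMIC_VARIABLE(get, set, cas, val)`, where `self v` is the recursive call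
`ATOMIC_VARIABLE(get, set, cas, v)`. -/
def atomicVariable {V : Type} [DecidableEq V] (get set : V → Event N)
    (cas : V → V → Bool → Event N) (self : V → CProc N) (val : V) : CProc N :=
  ext (get val ⇾ self val) <|
  ext (input set fun newVal => self newVal) <|
  input (fun x : V × V => cas x.1 x.2 (decide (x.1 = val))) fun x =>
    if x.1 = val then self x.2 else self val

instance : DecidableEq PState := fun a b => by
  cases a <;> cases b <;> first | exact isTrue rfl | exact isFalse (fun h => nomatch h)

def ownerVarBody (v : PID N) : CProc N :=
  atomicVariable (owner .load) (owner .store) casOwner (fun v => call (.ownerVar v)) v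

def stateVarBody (p : NonNullPID N) (v : PState) : CProc N :=
  atomicVariable (state .load p) (state .store p) (casState p) (fun v => call (.stateVar p v)) v

def OWNER : CProc N := call (.ownerVar none)

def STATE_VAR : CProc N := interAll fun p : NonNullPID N => call (.stateVar p .ACTIVE)

/-! ### The concurrent queue -/

def queueUserBody (p : NonNullPID N) : CProc N :=
  ext (input (enqueue p) fun v => linEnqueue p v ⇾ endEnqueue p ⇾ call (.queueUser p)) <|
  ext (dequeue p ⇾ input (linDequeue p) fun v => ret p v ⇾ call (.queueUser p)) <|
  (peek p ⇾ input (linPeek p) fun v => ret p v ⇾ call (.queueUser p))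

/-- `max` is the bound in the guard `length(q) ≤ max`. -/
def queueSpecBody (max : ℕ) (q : List (NonNullPID N)) : CProc N :=
  if q.length ≤ max then
    ext (input (fun x : NonNullPID N × NonNullPID N => enqueue x.1 x.2)
      fun _ => call (.queueSpec q)) <|
    ext (input (fun x : NonNullPID N × NonNullPID N => linEnqueue x.1 x.2)
      fun x => call (.queueSpec (q ++ [x.2]))) <|
    ext (input endEnqueue fun _ => call (.queueSpec q)) <|
    ext (input dequeue fun _ => call (.queueSpec q)) <|
    ext (input (fun p => linDequeue p q.head?) fun _ => call (.queueSpec q.tail)) <|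
    ext (input peek fun _ => call (.queueSpec q)) <|
    ext (input (fun p => linPeek p q.head?) fun _ => call (.queueSpec q)) <|
    input (fun x : NonNullPID N × PID N => ret x.1 x.2) fun _ => call (.queueSpec q)
  else STOP

/-- The interface of the queue to its environment. -/
def queueAlpha : Set (Event N) :=
  {e | (∃ p v, e = enqueue p v) ∨ (∃ p, e = endEnqueue p) ∨ (∃ p, e = dequeue p) ∨
    (∃ p, e = peek p) ∨ ∃ p v, e = ret p v}

/-- `SYNC` -/
def queueSync : Set (Event N) :=
  queueAlpha ∪ {e | (∃ p v, e = linEnqueue p v) ∨ (∃ p v, e = linDequeue p v) ∨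
    ∃ p v, e = linPeek p v}

/-- The queue, with the events in `hidden` concealed. -/
def QUEUE (hidden : Set (Event N)) : CProc N :=
  hide (par queueSync (interAll fun p : NonNullPID N => call (.queueUser p)) (call (.queueSpec [])))
    hidden

/-! ### The claim/release protocol -/

def YIELD (pid : NonNullPID N) : CProc N :=
  state .load pid .SCHEDULED ⇾ state .store pid .ACTIVE ⇾ SKIP

def SCHEDULE (pid : NonNullPID N) : CProc N :=
  input (casState pid .ENGAGING .SCHEDULED) fun succ =>
    if ¬ succ then input (casState pid .WAITING .SCHEDULED) fun _ => SKIP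
    else SKIP

def CLAIM (pid : NonNullPID N) : CProc N :=
  beginClaim pid ⇾
  state .store pid .ENGAGING ⇾
  enqueue pid pid ⇾ endEnqueue pid ⇾
  peek pid ⇾ input (ret pid) fun headQ =>
  if headQ = some pid then
    input (casOwner none (some pid)) fun succ =>
    if succ then state .store pid .ACTIVE ⇾ endClaim pid ⇾ SKIP
    else
      input (owner .load) fun own =>
      if own = none then
        owner .store (some pid) ⇾ state .store pid .ACTIVE ⇾ endClaim pid ⇾ SKIP
      else if own = some pid then
        input (casState pid .ENGAGING .WAITING) fun succ =>
        if succ then seq (YIELD pid) (endClaim pid ⇾ SKIP)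
        else state .store pid .ACTIVE ⇾ endClaim pid ⇾ SKIP
      else
        input (casOwner own (some pid)) fun succ =>
        if succ then state .store pid .ACTIVE ⇾ endClaim pid ⇾ SKIP
        else
          input (casOwner none (some pid)) fun succ =>
          if succ then state .store pid .ACTIVE ⇾ endClaim pid ⇾ SKIP
          else
            input (casState pid .ENGAGING .WAITING) fun succ =>
            if succ then seq (YIELD pid) (endClaim pid ⇾ SKIP)
            else state .store pid .ACTIVE ⇾ endClaim pid ⇾ SKIP
  else
    input (casState pid .ENGAGING .WAITING) fun succ =>
    if succ then seq (YIELD pid) (endClaim pid ⇾ SKIP)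
    else state .store pid .ACTIVE ⇾ endClaim pid ⇾ SKIP

def RELEASE (pid : NonNullPID N) : CProc N :=
  beginRelease pid ⇾
  dequeue pid ⇾ ret pid (some pid) ⇾
  peek pid ⇾ input (ret pid) fun headQ =>
  match headQ with
  | none => input (casOwner (some pid) none) fun _ => endRelease pid ⇾ SKIP
  | some h =>
    input (casOwner (some pid) (some h)) fun succ =>
    if succ then seq (SCHEDULE h) (endRelease pid ⇾ SKIP)
    else endRelease pid ⇾ SKIP

def userBody (pid : NonNullPID N) : CProc N :=
  seq (CLAIM pid) (seq (RELEASE pid) (call (.user pid)))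

/-- The events in which the users interact with the shared variables and the queue. -/
def DATA : Set (Event N) :=
  queueAlpha ∪ {e | (∃ op v, e = owner op v) ∨ (∃ x y b, e = casOwner x y b) ∨
    (∃ op p v, e = state op p v) ∨ ∃ p x y b, e = casState p x y b}

/-- The system, in which the queue conceals the events in `hidden`. -/
def SYSTEM (hidden : Set (Event N)) : CProc N :=
  par DATA (inter (inter (QUEUE hidden) STATE_VAR) OWNER)
    (interAll fun p : NonNullPID N => call (.user p))

/-! ### Fairness -/

/-- The events `begin_claim`, `lin_enqueue` and `end_claim`. -/
def exposed : Set (Event N) :=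
  {e | (∃ p, e = beginClaim p) ∨ (∃ p v, e = linEnqueue p v) ∨ ∃ p, e = endClaim p}

/-- The implementation, exposing only `begin_claim`, `lin_enqueue` and `end_claim`. -/
def FAIR_IMPL (N : ℕ) : CProc N :=
  hide (SYSTEM {e | (∃ p v, e = linDequeue p v) ∨ ∃ p v, e = linPeek p v}) exposedᶜ

def fairBody (claims : Finset (NonNullPID N)) (waiting : List (NonNullPID N)) : CProc N :=
  ext (inputFrom {pid | pid ∉ claims} beginClaim fun pid =>
    call (.fair (claims ∪ {pid}) waiting)) <|
  ext (inputFrom {pid | pid ∈ claims ∧ pid ∉ waiting} (fun pid => linEnqueue pid pid) fun pid =>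
    call (.fair claims (waiting ++ [pid]))) <|
  match waiting with
  | [] => STOP
  | h :: rest => endClaim h ⇾ call (.fair (claims \ {h}) rest)

/-- The oracle, started with no claims and nobody waiting. -/
def FAIR (N : ℕ) : CProc N := call (.fair ∅ [])

/-- The process definitions. -/
def procDefs (N max : ℕ) : PName N → CProc N
  | .ownerVar v => ownerVarBody v
  | .stateVar p v => stateVarBody p v
  | .queueUser p => queueUserBody p
  | .queueSpec q => queueSpecBody max q
  | .user p => userBody p
  | .fair claims waiting => fairBody claims waiting

/-! ### Orders of events in a trace -/

/-- The processes of the `begin_claim` events, in order. -/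
def beginOrder (t : List (Obs (Event N))) : List (NonNullPID N) :=
  t.filterMap fun
    | .ev (beginClaim p) => some p
    | _ => none

/-- The processes of the `lin_enqueue` events, in order. -/
def enqueueOrder (t : List (Obs (Event N))) : List (NonNullPID N) :=
  t.filterMap fun
    | .ev (linEnqueue p _) => some p
    | _ => none

/-- The processes of the `end_claim` events, in order. -/
def endOrder (t : List (Obs (Event N))) : List (NonNullPID N) :=
  t.filterMap fun
    | .ev (endClaim p) => some p
    | _ => none

end ClaimRelease

/-! ## Inversion of transitions -/

section Inversion

variable {E K : Type} {D : K → Proc E K}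

/-! The implementation is reduced to an explicit transition system. A user and its part of the queue
are merged into one control point (`Pc`), so a global state (`State`) consists of control points,
queue contents, state variables and owner, and each process has at most one transition, `next`.
Every CSP transition of `State.term` is a `next` (`exists_next_of_step`), and every `next` is
enabled while the queue is within its bound (`step_of_next`).

Safety rests on the invariant `State.Inv`: a process entitled to proceed is both the owner and the
head of the queue, while an owner that is no longer in the queue is about to pass ownership on. A
process that has seen itself at the head stays there until it dequeues, so nobody else takes
ownership from NULL or from a leaving owner in the meantime; its only rival is the hand-over of that
leaving owner, and the CAS on the owner decides between them. A head that is going to park either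
has ownership or will be handed it, so no wake-up is lost. `Inv.of_next` shows that the invariant is
preserved.

The refinement map `State.oracle` sends a state to the set of claiming processes and the queue
without those processes that have already ended their claims. Internal actions leave it unchanged
(`claims_internal`, `Inv.waiting_internal`), and visible ones are steps of the oracle
(`Inv.step_oracle`); claims end in queue order because a holder is the head.

Each internal action lowers the sum of the ranks, so nothing diverges (`not_diverges`). In a stable
state every process is idle, about to commit its enqueue, about to end its claim, or parked and
unscheduled. The invariant rules out the last for the head of the queue, since some other process
would still have an internal action. Hence all offers of the oracle are available (`Inv.offers`),
and whatever the implementation refuses the oracle refuses too. The statements about orders of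
events are proved for the oracle and hold for the implementation by trace inclusion. -/

theorem step_STOP {a : Act E} {R : Proc E K} : ¬ Step D .STOP a R := by
  rintro ⟨⟩

theorem step_SKIP {a : Act E} {R : Proc E K} : Step D .SKIP a R ↔ a = .tick ∧ R = .omega := by
  constructor
  · rintro ⟨⟩; exact ⟨rfl, rfl⟩
  · rintro ⟨rfl, rfl⟩; exact .skip

theorem step_pre {e : E} {P R : Proc E K} {a : Act E} :
    Step D (.pre e P) a R ↔ a = .ev e ∧ R = P := by
  constructor
  · rintro ⟨⟩; exact ⟨rfl, rfl⟩
  · rintro ⟨rfl, rfl⟩; exact .pre _ _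

theorem step_call {k : K} {a : Act E} {R : Proc E K} : Step D (.call k) a R ↔ Step D (D k) a R :=
  ⟨fun h => by cases h; assumption, .call⟩

theorem step_extAll_pre {α : Type} {c : α → E} {P : α → Proc E K} {a : Act E} {R : Proc E K} :
    Step D (.extAll fun x => .pre (c x) (P x)) a R ↔ ∃ x, a = .ev (c x) ∧ R = P x := by
  constructor
  · intro h
    cases h with
    | extAll_tau i h _ => cases h
    | extAll_vis i h => cases h; exact ⟨i, rfl, rfl⟩
  · rintro ⟨x, rfl, rfl⟩; exact .extAll_vis x (.pre _ _)

theorem step_input {α : Type} {c : α → E} {P : α → Proc E K} {a : Act E} {R : Proc E K} :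
    Step D (Proc.input c P) a R ↔ ∃ x, a = .ev (c x) ∧ R = P x :=
  step_extAll_pre

theorem step_inputFrom {α : Type} {S : Set α} {c : α → E} {P : α → Proc E K} {a : Act E}
    {R : Proc E K} :
    Step D (Proc.inputFrom S c P) a R ↔ ∃ x ∈ S, a = .ev (c x) ∧ R = P x := by
  unfold Proc.inputFrom
  rw [step_extAll_pre (c := fun x : S => c x) (P := fun x : S => P x)]
  simp [and_left_comm]

theorem step_ext_vis {P Q R : Proc E K} {o : Obs E} :
    Step D (.ext P Q) (.vis o) R ↔ Step D P (.vis o) R ∨ Step D Q (.vis o) R := by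
  constructor
  · intro h
    cases h with
    | ext_left h => exact .inl h
    | ext_right h => exact .inr h
  · rintro (h | h)
    · exact .ext_left h
    · exact .ext_right h

theorem step_ext_tau {P Q R : Proc E K} :
    Step D (.ext P Q) .tau R ↔ (∃ P', Step D P .tau P' ∧ R = .ext P' Q) ∨
      ∃ Q', Step D Q .tau Q' ∧ R = .ext P Q' := by
  constructor
  · intro h
    cases h with
    | ext_tau_left h => exact .inl ⟨_, h, rfl⟩
    | ext_tau_right h => exact .inr ⟨_, h, rfl⟩
  · rintro (⟨_, h, rfl⟩ | ⟨_, h, rfl⟩)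
    · exact .ext_tau_left h
    · exact .ext_tau_right h

/-- An internal action does not resolve a choice, whereas a visible one does. Without internal
actions on either side only the second kind is left, and one formula covers all actions. -/
theorem step_ext_of_stable {P Q R : Proc E K} {a : Act E} (hP : ∀ P', ¬ Step D P .tau P')
    (hQ : ∀ Q', ¬ Step D Q .tau Q') :
    Step D (.ext P Q) a R ↔ Step D P a R ∨ Step D Q a R := by
  cases a with
  | tau => simp [step_ext_tau, hP, hQ]
  | vis o => exact step_ext_vis

theorem step_seq {P Q R : Proc E K} {a : Act E} :
    Step D (.seq P Q) a R ↔ (a ≠ .tick ∧ ∃ P', Step D P a P' ∧ R = .seq P' Q) ∨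
      (a = .tau ∧ R = Q ∧ ∃ P', Step D P .tick P') := by
  constructor
  · intro h
    cases h with
    | seq_left ha h => exact .inl ⟨ha, _, h, rfl⟩
    | seq_tick h => exact .inr ⟨rfl, rfl, _, h⟩
  · rintro (⟨ha, _, h, rfl⟩ | ⟨rfl, rfl, _, h⟩)
    · exact .seq_left ha h
    · exact .seq_tick h

theorem step_hide {P R : Proc E K} {A : Set E} {a : Act E} (hP : ∀ P', ¬ Step D P .tick P') :
    Step D (.hide P A) a R ↔ ∃ P', R = .hide P' A ∧ ((a = .tau ∧ Step D P .tau P') ∨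
      ∃ e, Step D P (.ev e) P' ∧ ((e ∈ A ∧ a = .tau) ∨ (e ∉ A ∧ a = .ev e))) := by
  constructor
  · intro h
    cases h with
    | hide_tau h => exact ⟨_, rfl, .inl ⟨rfl, h⟩⟩
    | hide_mem he h => exact ⟨_, rfl, .inr ⟨_, h, .inl ⟨he, rfl⟩⟩⟩
    | hide_not_mem he h => exact ⟨_, rfl, .inr ⟨_, h, .inr ⟨he, rfl⟩⟩⟩
    | hide_tick h => exact absurd h (hP _)
  · rintro ⟨_, rfl, ⟨rfl, h⟩ | ⟨e, h, ⟨he, rfl⟩ | ⟨he, rfl⟩⟩⟩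
    · exact .hide_tau h
    · exact .hide_mem he h
    · exact .hide_not_mem he h

/-- A parallel composition of processes that cannot terminate. -/
theorem step_par {P Q R : Proc E K} {A : Set E} {a : Act E} (hP : ∀ P', ¬ Step D P .tick P')
    (hQ : ∀ Q', ¬ Step D Q .tick Q') (ho : P ≠ .omega) :
    Step D (.par A P Q) a R ↔
      (∃ P', (a = .tau ∨ ∃ e ∉ A, a = .ev e) ∧ Step D P a P' ∧ R = .par A P' Q) ∨
      (∃ Q', (a = .tau ∨ ∃ e ∉ A, a = .ev e) ∧ Step D Q a Q' ∧ R = .par A P Q') ∨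
      (∃ e ∈ A, ∃ P' Q', a = .ev e ∧ Step D P (.ev e) P' ∧ Step D Q (.ev e) Q' ∧
        R = .par A P' Q') := by
  constructor
  · intro h
    cases h with
    | par_tau_left h => exact .inl ⟨_, .inl rfl, h, rfl⟩
    | par_tau_right h => exact .inr (.inl ⟨_, .inl rfl, h, rfl⟩)
    | par_left he h => exact .inl ⟨_, .inr ⟨_, he, rfl⟩, h, rfl⟩
    | par_right he h => exact .inr (.inl ⟨_, .inr ⟨_, he, rfl⟩, h, rfl⟩)
    | par_sync he h h' => exact .inr (.inr ⟨_, he, _, _, rfl, h, h', rfl⟩)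
    | par_tick_left h => exact absurd h (hP _)
    | par_tick_right h => exact absurd h (hQ _)
    | par_tick => exact absurd rfl ho
  · rintro (⟨_, rfl | ⟨e, he, rfl⟩, h, rfl⟩ | ⟨_, rfl | ⟨e, he, rfl⟩, h, rfl⟩ |
      ⟨e, he, _, _, rfl, h, h', rfl⟩)
    · exact .par_tau_left h
    · exact .par_left he h
    · exact .par_tau_right h
    · exact .par_right he h
    · exact .par_sync he h h'

theorem step_inter {P Q R : Proc E K} {a : Act E} (hP : ∀ P', ¬ Step D P .tick P')
    (hQ : ∀ Q', ¬ Step D Q .tick Q') (ho : P ≠ .omega) :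
    Step D (Proc.inter P Q) a R ↔
      (∃ P', Step D P a P' ∧ R = Proc.inter P' Q) ∨
      (∃ Q', Step D Q a Q' ∧ R = Proc.inter P Q') := by
  unfold Proc.inter
  rw [step_par hP hQ ho]
  rcases a with _ | e | _
  · simp
  · simp
  · simp [hP, hQ]

/-- The index type must be nonempty because an empty interleaving terminates at once. -/
theorem step_interAll {α : Type} [DecidableEq α] [Nonempty α] {P : α → Proc E K} {R : Proc E K}
    {a : Act E} (hP : ∀ i P', ¬ Step D (P i) .tick P') (ho : ∀ i, P i ≠ .omega) :
    Step D (.interAll P) a R ↔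
      ∃ i X, Step D (P i) a X ∧ R = .interAll (Function.update P i X) := by
  constructor
  · intro h
    cases h with
    | @interAll_step _ _ Q _ i ha h hQ =>
      refine ⟨i, _, h, congrArg _ ?_⟩
      funext j
      by_cases hj : j = i
      · subst hj; simp
      · simp [hj, hQ]
    | interAll_tick_one i h => exact absurd h (hP _ _)
    | interAll_tick h => exact absurd (h (Classical.arbitrary α)) (ho _)
  · rintro ⟨i, X, h, rfl⟩
    refine .interAll_step i ?_ (by simpa using h) (fun j hj => by simp [hj])
    rintro rfl
    exact hP _ _ h

/-- Interleaving of components of the form `f i (c i)`. -/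
theorem step_interAll_family {α β : Type} [DecidableEq α] [Nonempty α] {f : α → β → Proc E K}
    {move : α → β → Act E → β → Prop}
    (hf : ∀ i b a X, Step D (f i b) a X ↔ ∃ b', move i b a b' ∧ X = f i b')
    (ht : ∀ i b b', ¬ move i b .tick b') (ho : ∀ i b, f i b ≠ .omega)
    {c : α → β} {R : Proc E K} {a : Act E} :
    Step D (.interAll fun i => f i (c i)) a R ↔
      ∃ i b, move i (c i) a b ∧ R = .interAll fun j => f j (Function.update c i b j) := by
  rw [step_interAll (by simp [hf, ht]) (fun i => ho i _)]
  have key : ∀ i b, (Function.update (fun i => f i (c i)) i (f i b)) =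
      fun j => f j (Function.update c i b j) := fun i b => by
    funext j
    exact (Function.apply_update f c i b j).symm
  constructor
  · rintro ⟨i, X, h, rfl⟩
    obtain ⟨b, hb, rfl⟩ := (hf ..).1 h
    exact ⟨i, b, hb, by rw [key]⟩
  · rintro ⟨i, b, hb, rfl⟩
    exact ⟨i, f i b, (hf ..).2 ⟨b, hb, rfl⟩, by rw [key]⟩

end Inversion

/-! ## The components of the system as labelled transition tables -/

namespace ClaimRelease

open Proc Event

variable {N : ℕ}

/-- The transitions of the owner variable. -/
def ownerMove (v : PID N) : Event N → PID N → Prop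
  | owner .load x, v' => x = v ∧ v' = v
  | owner .store x, v' => v' = x
  | casOwner x y b, v' => b = decide (x = v) ∧ v' = if x = v then y else v
  | _, _ => False

/-- The transitions of a state variable. -/
def stateMove (p : NonNullPID N) (v : PState) : Event N → PState → Prop
  | state .load p' x, v' => p' = p ∧ x = v ∧ v' = v
  | state .store p' x, v' => p' = p ∧ v' = x
  | casState p' x y b, v' => p' = p ∧ b = decide (x = v) ∧ v' = if x = v then y else v
  | _, _ => False

theorem step_atomicVariable {V : Type} [DecidableEq V] {D : PName N → CProc N}
    {get set : V → Event N} {cas : V → V → Bool → Event N} {self : V → CProc N} {val : V}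
    {a : Act (Event N)} {R : CProc N} :
    Step D (atomicVariable get set cas self val) a R ↔
      (a = .ev (get val) ∧ R = self val) ∨ (∃ x, a = .ev (set x) ∧ R = self x) ∨
      ∃ x y, a = .ev (cas x y (decide (x = val))) ∧ R = self (if x = val then y else val) := by
  unfold atomicVariable
  rw [step_ext_of_stable (by simp [step_pre])
      (by simp [step_ext_tau, step_input]), step_ext_of_stable (by simp [step_input])
      (by simp [step_input]), step_pre, step_input, step_input]
  simp only [Prod.exists, apply_ite self]

theorem step_ownerVar {max : ℕ} {v : PID N} {a : Act (Event N)} {R : CProc N} :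
    Step (procDefs N max) (call (.ownerVar v)) a R ↔
      ∃ e v', a = .ev e ∧ ownerMove v e v' ∧ R = call (.ownerVar v') := by
  rw [step_call]
  show Step _ (ownerVarBody v) a R ↔ _
  rw [ownerVarBody, step_atomicVariable]
  constructor
  · rintro (⟨rfl, rfl⟩ | ⟨x, rfl, rfl⟩ | ⟨x, y, rfl, rfl⟩)
    · exact ⟨_, _, rfl, ⟨rfl, rfl⟩, rfl⟩
    · exact ⟨_, _, rfl, rfl, rfl⟩
    · exact ⟨_, _, rfl, ⟨rfl, rfl⟩, rfl⟩
  · rintro ⟨e, v', rfl, h, rfl⟩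
    rcases e with (_ | _) | _ | _ | _ | _ | _ | _ | _ | _ | _ | _ | _ | _ | _ | _ | _ <;>
      simp only [ownerMove] at h
    · obtain ⟨rfl, rfl⟩ := h; exact .inl ⟨rfl, rfl⟩
    · subst h; exact .inr (.inl ⟨_, rfl, rfl⟩)
    · obtain ⟨rfl, rfl⟩ := h; exact .inr (.inr ⟨_, _, rfl, rfl⟩)

theorem step_stateVar {max : ℕ} {p : NonNullPID N} {v : PState} {a : Act (Event N)}
    {R : CProc N} :
    Step (procDefs N max) (call (.stateVar p v)) a R ↔
      ∃ v', (∃ e, a = .ev e ∧ stateMove p v e v') ∧ R = call (.stateVar p v') := by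
  rw [step_call]
  show Step _ (stateVarBody p v) a R ↔ _
  rw [stateVarBody, step_atomicVariable]
  constructor
  · rintro (⟨rfl, rfl⟩ | ⟨x, rfl, rfl⟩ | ⟨x, y, rfl, rfl⟩)
    · exact ⟨_, ⟨_, rfl, ⟨rfl, rfl, rfl⟩⟩, rfl⟩
    · exact ⟨_, ⟨_, rfl, rfl, rfl⟩, rfl⟩
    · exact ⟨_, ⟨_, rfl, ⟨rfl, rfl, rfl⟩⟩, rfl⟩
  · rintro ⟨v', ⟨e, rfl, h⟩, rfl⟩
    rcases e with _ | _ | (_ | _) | _ | _ | _ | _ | _ | _ | _ | _ | _ | _ | _ | _ | _ <;>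
      simp only [stateMove] at h
    · obtain ⟨rfl, rfl, rfl⟩ := h; exact .inl ⟨rfl, rfl⟩
    · obtain ⟨rfl, rfl⟩ := h; exact .inr (.inl ⟨_, rfl, rfl⟩)
    · obtain ⟨rfl, rfl, rfl⟩ := h; exact .inr (.inr ⟨_, _, rfl, rfl⟩)

/-! ### The queue -/

/-- The control points of the process that performs the queue operations of one user. -/
inductive QueuePc (N : ℕ) : Type
  | idle
  | enqueuing (v : NonNullPID N)
  | enqueued
  | dequeuing
  | peeking
  | returning (v : PID N)

def queueUserTerm (p : NonNullPID N) : QueuePc N → CProc N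
  | .idle => call (.queueUser p)
  | .enqueuing v => linEnqueue p v ⇾ endEnqueue p ⇾ call (.queueUser p)
  | .enqueued => endEnqueue p ⇾ call (.queueUser p)
  | .dequeuing => input (linDequeue p) fun v => ret p v ⇾ call (.queueUser p)
  | .peeking => input (linPeek p) fun v => ret p v ⇾ call (.queueUser p)
  | .returning v => ret p v ⇾ call (.queueUser p)

def queueUserMove (p : NonNullPID N) (k : QueuePc N) (a : Act (Event N)) (k' : QueuePc N) : Prop :=
  match k with
  | .idle => (∃ v, a = .ev (enqueue p v) ∧ k' = .enqueuing v) ∨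
      (a = .ev (dequeue p) ∧ k' = .dequeuing) ∨ (a = .ev (peek p) ∧ k' = .peeking)
  | .enqueuing v => a = .ev (linEnqueue p v) ∧ k' = .enqueued
  | .enqueued => a = .ev (endEnqueue p) ∧ k' = .idle
  | .dequeuing => ∃ v, a = .ev (linDequeue p v) ∧ k' = .returning v
  | .peeking => ∃ v, a = .ev (linPeek p v) ∧ k' = .returning v
  | .returning v => a = .ev (ret p v) ∧ k' = .idle

theorem step_queueUserTerm {max : ℕ} (p : NonNullPID N) (k : QueuePc N) (a : Act (Event N))
    (R : CProc N) :
    Step (procDefs N max) (queueUserTerm p k) a R ↔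
      ∃ k', queueUserMove p k a k' ∧ R = queueUserTerm p k' := by
  cases k with
  | idle =>
    simp only [queueUserTerm]
    rw [step_call]
    show Step _ (queueUserBody p) a R ↔ _
    unfold queueUserBody
    rw [step_ext_of_stable (by simp [step_input]) (by simp [step_ext_tau, step_pre]),
      step_ext_of_stable (by simp [step_pre]) (by simp [step_pre]), step_input, step_pre, step_pre]
    constructor
    · rintro (⟨v, rfl, rfl⟩ | ⟨rfl, rfl⟩ | ⟨rfl, rfl⟩)
      · exact ⟨.enqueuing v, .inl ⟨v, rfl, rfl⟩, rfl⟩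
      · exact ⟨.dequeuing, .inr (.inl ⟨rfl, rfl⟩), rfl⟩
      · exact ⟨.peeking, .inr (.inr ⟨rfl, rfl⟩), rfl⟩
    · rintro ⟨_, ⟨v, rfl, rfl⟩ | ⟨rfl, rfl⟩ | ⟨rfl, rfl⟩, rfl⟩
      · exact .inl ⟨v, rfl, rfl⟩
      · exact .inr (.inl ⟨rfl, rfl⟩)
      · exact .inr (.inr ⟨rfl, rfl⟩)
  | enqueuing v => simp [queueUserTerm, queueUserMove, step_pre, and_assoc]
  | enqueued => simp [queueUserTerm, queueUserMove, step_pre, and_assoc]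
  | returning v => simp [queueUserTerm, queueUserMove, step_pre, and_assoc]
  | dequeuing =>
    simp only [queueUserTerm, queueUserMove, step_input]
    constructor
    · rintro ⟨v, rfl, rfl⟩; exact ⟨_, ⟨v, rfl, rfl⟩, rfl⟩
    · rintro ⟨_, ⟨v, rfl, rfl⟩, rfl⟩; exact ⟨v, rfl, rfl⟩
  | peeking =>
    simp only [queueUserTerm, queueUserMove, step_input]
    constructor
    · rintro ⟨v, rfl, rfl⟩; exact ⟨_, ⟨v, rfl, rfl⟩, rfl⟩
    · rintro ⟨_, ⟨v, rfl, rfl⟩, rfl⟩; exact ⟨v, rfl, rfl⟩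

theorem queueUserMove_ev {p : NonNullPID N} {k k' : QueuePc N} {a : Act (Event N)}
    (h : queueUserMove p k a k') : ∃ e ∈ queueSync, a = .ev e := by
  cases k <;> simp only [queueUserMove] at h
  · rcases h with ⟨v, rfl, _⟩ | ⟨rfl, _⟩ | ⟨rfl, _⟩ <;>
      exact ⟨_, by simp [queueSync, queueAlpha], rfl⟩
  · exact ⟨_, by simp [queueSync, queueAlpha], h.1⟩
  · exact ⟨_, by simp [queueSync, queueAlpha], h.1⟩
  · obtain ⟨v, h, _⟩ := h
    exact ⟨_, by simp [queueSync, queueAlpha], h⟩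
  · obtain ⟨v, h, _⟩ := h
    exact ⟨_, by simp [queueSync, queueAlpha], h⟩
  · exact ⟨_, by simp [queueSync, queueAlpha], h.1⟩

/-- The transitions of the queue, apart from the guard on its length. -/
def queueSpecMove (q : List (NonNullPID N)) : Event N → List (NonNullPID N) → Prop
  | enqueue _ _, q' => q' = q
  | endEnqueue _, q' => q' = q
  | dequeue _, q' => q' = q
  | peek _, q' => q' = q
  | ret _ _, q' => q' = q
  | linEnqueue _ v, q' => q' = q ++ [v]
  | linDequeue _ v, q' => v = q.head? ∧ q' = q.tail
  | linPeek _ v, q' => v = q.head? ∧ q' = q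
  | _, _ => False

theorem step_queueSpec {max : ℕ} {q : List (NonNullPID N)} {a : Act (Event N)} {R : CProc N} :
    Step (procDefs N max) (call (.queueSpec q)) a R ↔
      ∃ e q', a = .ev e ∧ q.length ≤ max ∧ queueSpecMove q e q' ∧ R = call (.queueSpec q') := by
  rw [step_call]
  show Step _ (queueSpecBody max q) a R ↔ _
  unfold queueSpecBody
  split_ifs with hq
  · rw [step_ext_of_stable, step_ext_of_stable, step_ext_of_stable, step_ext_of_stable,
      step_ext_of_stable, step_ext_of_stable, step_ext_of_stable]
    rotate_left
    iterate 14 simp [step_input, step_ext_tau]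
    simp only [step_input]
    constructor
    · rintro (⟨x, rfl, rfl⟩ | ⟨x, rfl, rfl⟩ | ⟨x, rfl, rfl⟩ | ⟨x, rfl, rfl⟩ | ⟨x, rfl, rfl⟩ |
        ⟨x, rfl, rfl⟩ | ⟨x, rfl, rfl⟩ | ⟨x, rfl, rfl⟩) <;>
      exact ⟨_, _, rfl, hq, by first | rfl | exact ⟨rfl, rfl⟩, rfl⟩
    · rintro ⟨e, q', rfl, -, h, rfl⟩
      cases e <;> simp only [queueSpecMove] at h <;> try (first | subst h | obtain ⟨rfl, rfl⟩ := h)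
      all_goals simp
  · simp [step_STOP, hq]

/-- The queue with its users at the control points `k` and contents `q`. -/
def queueTerm (k : NonNullPID N → QueuePc N) (q : List (NonNullPID N)) : CProc N :=
  hide (par queueSync (interAll fun p => queueUserTerm p (k p)) (call (.queueSpec q)))
    {e | (∃ p v, e = linDequeue p v) ∨ ∃ p v, e = linPeek p v}

theorem step_queueTerm {max : ℕ} [NeZero N] {k : NonNullPID N → QueuePc N}
    {q : List (NonNullPID N)} {a : Act (Event N)} {R : CProc N} :
    Step (procDefs N max) (queueTerm k q) a R ↔
      ∃ p e k' q', queueUserMove p (k p) (.ev e) k' ∧ q.length ≤ max ∧ queueSpecMove q e q' ∧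
        R = queueTerm (Function.update k p k') q' ∧
        ((((∃ p v, e = linDequeue p v) ∨ ∃ p v, e = linPeek p v) ∧ a = .tau) ∨
          (¬ ((∃ p v, e = linDequeue p v) ∨ ∃ p v, e = linPeek p v) ∧ a = .ev e)) := by
  have users : ∀ a R, Step (procDefs N max) (interAll fun p => queueUserTerm p (k p)) a R ↔
      ∃ p k', queueUserMove p (k p) a k' ∧
        R = interAll fun j => queueUserTerm j (Function.update k p k' j) := fun a R =>
    step_interAll_family step_queueUserTerm
      (fun p k k' h => by obtain ⟨e, _, h⟩ := queueUserMove_ev h; cases h)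
      (fun p k => by cases k <;> simp [queueUserTerm, input])
  have hu : ∀ R, ¬ Step (procDefs N max) (interAll fun p => queueUserTerm p (k p)) .tick R := by
    intro R h
    obtain ⟨p, k', h, -⟩ := (users ..).1 h
    obtain ⟨e, _, h⟩ := queueUserMove_ev h; cases h
  have hs : ∀ R, ¬ Step (procDefs N max) (call (.queueSpec q)) .tick R := by
    simp [step_queueSpec]
  -- Both sides perform only events of `queueSync`, so every transition of the composition is a
  -- synchronisation.
  have inner : ∀ a R, Step (procDefs N max)
      (par queueSync (interAll fun p => queueUserTerm p (k p)) (call (.queueSpec q))) a R ↔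
      ∃ p e k' q', a = .ev e ∧ queueUserMove p (k p) (.ev e) k' ∧ q.length ≤ max ∧
        queueSpecMove q e q' ∧
        R = par queueSync (interAll fun j => queueUserTerm j (Function.update k p k' j))
          (call (.queueSpec q')) := by
    intro a R
    rw [step_par hu hs (by simp)]
    constructor
    · rintro (⟨P', ha, h, rfl⟩ | ⟨P', ha, h, rfl⟩ | ⟨e, he, P', Q', rfl, hP, hQ, rfl⟩)
      · obtain ⟨p, k', h, -⟩ := (users ..).1 h
        obtain ⟨e, he, rfl⟩ := queueUserMove_ev h
        obtain ha | ⟨e', he', ha⟩ := ha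
        · cases ha
        · cases ha; exact absurd he he'
      · obtain ⟨e, q', rfl, -, h, -⟩ := step_queueSpec.1 h
        obtain ha | ⟨e', he', ha⟩ := ha
        · cases ha
        · cases ha
          cases e <;> simp only [queueSpecMove] at h <;> simp [queueSync, queueAlpha] at he'
      · obtain ⟨p, k', h, rfl⟩ := (users ..).1 hP
        obtain ⟨e, q', ha, hl, h', rfl⟩ := step_queueSpec.1 hQ
        cases ha
        exact ⟨p, e, k', q', rfl, h, hl, h', rfl⟩
    · rintro ⟨p, e, k', q', rfl, h, hl, h', rfl⟩
      obtain ⟨e', he, ha⟩ := queueUserMove_ev h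
      cases ha
      exact .inr (.inr ⟨e, he, _, _, rfl, (users ..).2 ⟨p, k', h, rfl⟩,
        step_queueSpec.2 ⟨e, q', rfl, hl, h', rfl⟩, rfl⟩)
  unfold queueTerm
  rw [step_hide (fun P' h => by obtain ⟨_, _, _, _, h, _⟩ := (inner ..).1 h; cases h)]
  constructor
  · rintro ⟨P', rfl, ⟨rfl, h⟩ | ⟨e, h, h'⟩⟩
    · obtain ⟨_, _, _, _, h, _⟩ := (inner ..).1 h; cases h
    · obtain ⟨p, e, k', q', he, hk, hl, hq, rfl⟩ := (inner ..).1 h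
      cases he
      exact ⟨p, e, k', q', hk, hl, hq, rfl, h'⟩
  · rintro ⟨p, e, k', q', hk, hl, hq, rfl, h'⟩
    exact ⟨_, rfl, .inr ⟨e, (inner ..).2 ⟨p, e, k', q', rfl, hk, hl, hq, rfl⟩, h'⟩⟩

/-! ### Queue and shared variables together -/

/-- The queue and the shared variables. -/
def dataTerm (k : NonNullPID N → QueuePc N) (q : List (NonNullPID N))
    (st : NonNullPID N → PState) (own : PID N) : CProc N :=
  inter (inter (queueTerm k q) (interAll fun p => call (.stateVar p (st p))))
    (call (.ownerVar own))

theorem step_dataTerm {max : ℕ} [NeZero N] {k : NonNullPID N → QueuePc N}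
    {q : List (NonNullPID N)} {st : NonNullPID N → PState} {own : PID N} {a : Act (Event N)}
    {R : CProc N} :
    Step (procDefs N max) (dataTerm k q st own) a R ↔
      (∃ p e k' q', queueUserMove p (k p) (.ev e) k' ∧ q.length ≤ max ∧ queueSpecMove q e q' ∧
        R = dataTerm (Function.update k p k') q' st own ∧
        ((((∃ p v, e = linDequeue p v) ∨ ∃ p v, e = linPeek p v) ∧ a = .tau) ∨
          (¬ ((∃ p v, e = linDequeue p v) ∨ ∃ p v, e = linPeek p v) ∧ a = .ev e))) ∨
      (∃ p e v, a = .ev e ∧ stateMove p (st p) e v ∧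
        R = dataTerm k q (Function.update st p v) own) ∨
      (∃ e v, a = .ev e ∧ ownerMove own e v ∧ R = dataTerm k q st v) := by
  have vars : ∀ a R, Step (procDefs N max) (interAll fun p => call (.stateVar p (st p))) a R ↔
      ∃ p v, (∃ e, a = .ev e ∧ stateMove p (st p) e v) ∧
        R = interAll fun j => call (.stateVar j (Function.update st p v j)) := fun a R =>
    step_interAll_family (f := fun p v => call (PName.stateVar p v))
      (move := fun p v a v' => ∃ e, a = .ev e ∧ stateMove p v e v')
      (fun p v a R => step_stateVar) (by simp) (by simp)
  have hq : ∀ R, ¬ Step (procDefs N max) (queueTerm k q) .tick R := by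
    intro R h
    obtain ⟨p, e, k', q', -, -, -, -, h⟩ := step_queueTerm.1 h
    simp at h
  have hv : ∀ R, ¬ Step (procDefs N max) (interAll fun p => call (.stateVar p (st p))) .tick R := by
    simp [vars]
  have hi := fun a R => step_inter (a := a) (R := R) hq hv (by simp [queueTerm])
  unfold dataTerm
  rw [step_inter (by simp [hi, hq, hv]) (by simp [step_ownerVar]) (by simp [inter])]
  simp only [hi, vars, step_queueTerm, step_ownerVar]
  constructor
  · rintro (⟨P', ⟨_, ⟨p, e, k', q', h1, h2, h3, rfl, h4⟩, rfl⟩ |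
      ⟨_, ⟨p, v, ⟨e, rfl, h⟩, rfl⟩, rfl⟩, rfl⟩ | ⟨_, ⟨e, v, rfl, h, rfl⟩, rfl⟩)
    · exact .inl ⟨p, e, k', q', h1, h2, h3, rfl, h4⟩
    · exact .inr (.inl ⟨p, e, v, rfl, h, rfl⟩)
    · exact .inr (.inr ⟨e, v, rfl, h, rfl⟩)
  · rintro (⟨p, e, k', q', h1, h2, h3, rfl, h4⟩ | ⟨p, e, v, rfl, h, rfl⟩ | ⟨e, v, rfl, h, rfl⟩)
    · exact .inl ⟨_, .inl ⟨_, ⟨p, e, k', q', h1, h2, h3, rfl, h4⟩, rfl⟩, rfl⟩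
    · exact .inl ⟨_, .inr ⟨_, ⟨p, v, ⟨e, rfl, h⟩, rfl⟩, rfl⟩, rfl⟩
    · exact .inr ⟨_, ⟨e, v, rfl, h, rfl⟩, rfl⟩

end ClaimRelease

/-! ## Users and the whole system -/

namespace ClaimRelease

open Proc Event

variable {N : ℕ}

/-- The control points of a user together with its part of the queue. -/
inductive Pc (N : ℕ) : Type
  | idle
  | engage
  | enqueue
  | linEnqueue
  | endEnqueue
  | peek
  | linPeek
  | peeked (v : PID N)
  | casFree
  | loadOwner
  | storeOwner
  | casFrom (o : NonNullPID N)
  | recas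
  | park
  | await
  | activate
  | yielded
  | succeed
  | endClaim
  | claimed
  | beginRelease
  | dequeue
  | linDequeue
  | dequeued (v : PID N)
  | repeek
  | linRepeek
  | repeeked (v : PID N)
  | handOver (v : PID N)
  | schedule (h : NonNullPID N)
  | reschedule (h : NonNullPID N)
  | scheduled
  | endRelease
  | released

/-- The part of the queue at a control point. -/
def Pc.queuePc (p : NonNullPID N) : Pc N → QueuePc N
  | .linEnqueue => .enqueuing p
  | .endEnqueue => .enqueued
  | .linPeek => .peeking
  | .peeked v => .returning v
  | .linDequeue => .dequeuing
  | .dequeued v => .returning v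
  | .linRepeek => .peeking
  | .repeeked v => .returning v
  | _ => .idle

section Terms

variable (p : NonNullPID N)

def releaseThenLoop : CProc N := seq (RELEASE p) (call (.user p))

def succeedTerm : CProc N := state .store p .ACTIVE ⇾ endClaim p ⇾ SKIP

def parkTerm : CProc N :=
  input (casState p .ENGAGING .WAITING) fun succ =>
    if succ then seq (YIELD p) (endClaim p ⇾ SKIP) else succeedTerm p

def recasTerm : CProc N :=
  input (casOwner none (some p)) fun succ => if succ then succeedTerm p else parkTerm p

def casFromTerm (own : PID N) : CProc N :=
  input (casOwner own (some p)) fun succ => if succ then succeedTerm p else recasTerm p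

def loadOwnerTerm : CProc N :=
  input (owner .load) fun own =>
    if own = none then owner .store (some p) ⇾ succeedTerm p
    else if own = some p then parkTerm p
    else casFromTerm p own

def peekedTerm : CProc N :=
  input (ret p) fun headQ =>
    if headQ = some p then
      input (casOwner none (some p)) fun succ => if succ then succeedTerm p else loadOwnerTerm p
    else parkTerm p

def handOverTerm (v : PID N) : CProc N :=
  match v with
  | none => input (casOwner (some p) none) fun _ => endRelease p ⇾ SKIP
  | some h =>
    input (casOwner (some p) (some h)) fun succ =>
    if succ then seq (SCHEDULE h) (endRelease p ⇾ SKIP)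
    else endRelease p ⇾ SKIP

def repeekedTerm : CProc N := input (ret p) fun headQ => handOverTerm p headQ

end Terms

/-- The user `p` at a control point. -/
def userTerm (p : NonNullPID N) : Pc N → CProc N
  | .idle => call (.user p)
  | .engage => seq (state .store p .ENGAGING ⇾ enqueue p p ⇾ endEnqueue p ⇾ peek p ⇾ peekedTerm p)
      (releaseThenLoop p)
  | .enqueue => seq (enqueue p p ⇾ endEnqueue p ⇾ peek p ⇾ peekedTerm p) (releaseThenLoop p)
  | .linEnqueue => seq (endEnqueue p ⇾ peek p ⇾ peekedTerm p) (releaseThenLoop p)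
  | .endEnqueue => seq (endEnqueue p ⇾ peek p ⇾ peekedTerm p) (releaseThenLoop p)
  | .peek => seq (peek p ⇾ peekedTerm p) (releaseThenLoop p)
  | .linPeek => seq (peekedTerm p) (releaseThenLoop p)
  | .peeked _ => seq (peekedTerm p) (releaseThenLoop p)
  | .casFree => seq (input (casOwner none (some p)) fun succ =>
      if succ then succeedTerm p else loadOwnerTerm p) (releaseThenLoop p)
  | .loadOwner => seq (loadOwnerTerm p) (releaseThenLoop p)
  | .storeOwner => seq (owner .store (some p) ⇾ succeedTerm p) (releaseThenLoop p)
  | .casFrom o => seq (casFromTerm p (some o)) (releaseThenLoop p)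
  | .recas => seq (recasTerm p) (releaseThenLoop p)
  | .park => seq (parkTerm p) (releaseThenLoop p)
  | .await => seq (seq (YIELD p) (endClaim p ⇾ SKIP)) (releaseThenLoop p)
  | .activate => seq (seq (state .store p .ACTIVE ⇾ SKIP) (endClaim p ⇾ SKIP)) (releaseThenLoop p)
  | .yielded => seq (seq SKIP (endClaim p ⇾ SKIP)) (releaseThenLoop p)
  | .succeed => seq (succeedTerm p) (releaseThenLoop p)
  | .endClaim => seq (endClaim p ⇾ SKIP) (releaseThenLoop p)
  | .claimed => seq SKIP (releaseThenLoop p)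
  | .beginRelease => releaseThenLoop p
  | .dequeue => seq (dequeue p ⇾ ret p (some p) ⇾ peek p ⇾ repeekedTerm p) (call (.user p))
  | .linDequeue => seq (ret p (some p) ⇾ peek p ⇾ repeekedTerm p) (call (.user p))
  | .dequeued _ => seq (ret p (some p) ⇾ peek p ⇾ repeekedTerm p) (call (.user p))
  | .repeek => seq (peek p ⇾ repeekedTerm p) (call (.user p))
  | .linRepeek => seq (repeekedTerm p) (call (.user p))
  | .repeeked _ => seq (repeekedTerm p) (call (.user p))
  | .handOver v => seq (handOverTerm p v) (call (.user p))
  | .schedule h => seq (seq (SCHEDULE h) (endRelease p ⇾ SKIP)) (call (.user p))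
  | .reschedule h => seq (seq (input (casState h .WAITING .SCHEDULED) fun _ => SKIP)
      (endRelease p ⇾ SKIP)) (call (.user p))
  | .scheduled => seq (seq SKIP (endRelease p ⇾ SKIP)) (call (.user p))
  | .endRelease => seq (endRelease p ⇾ SKIP) (call (.user p))
  | .released => seq SKIP (call (.user p))

/-- The transitions of the user `p`. At a control point inside a queue operation they are those
of the user, who does not see how far the queue is. -/
def userMove (p : NonNullPID N) (c : Pc N) (a : Act (Event N)) (c' : Pc N) : Prop :=
  match c with
  | .idle => a = .ev (beginClaim p) ∧ c' = .engage
  | .engage => a = .ev (state .store p .ENGAGING) ∧ c' = .enqueue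
  | .enqueue => a = .ev (enqueue p p) ∧ c' = .linEnqueue
  | .linEnqueue | .endEnqueue => a = .ev (endEnqueue p) ∧ c' = .peek
  | .peek => a = .ev (peek p) ∧ c' = .linPeek
  | .linPeek | .peeked _ => ∃ v, a = .ev (ret p v) ∧ c' = if v = some p then .casFree else .park
  | .casFree => ∃ b, a = .ev (casOwner none (some p) b) ∧
      c' = if b = true then .succeed else .loadOwner
  | .loadOwner => ∃ v : PID N, a = .ev (owner .load v) ∧
      c' = v.elim .storeOwner fun o => if o = p then .park else .casFrom o
  | .storeOwner => a = .ev (owner .store (some p)) ∧ c' = .succeed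
  | .casFrom o => ∃ b, a = .ev (casOwner (some o) (some p) b) ∧
      c' = if b = true then .succeed else .recas
  | .recas => ∃ b, a = .ev (casOwner none (some p) b) ∧ c' = if b = true then .succeed else .park
  | .park => ∃ b, a = .ev (casState p .ENGAGING .WAITING b) ∧
      c' = if b = true then .await else .succeed
  | .await => a = .ev (state .load p .SCHEDULED) ∧ c' = .activate
  | .activate => a = .ev (state .store p .ACTIVE) ∧ c' = .yielded
  | .yielded => a = .tau ∧ c' = .endClaim
  | .succeed => a = .ev (state .store p .ACTIVE) ∧ c' = .endClaim
  | .endClaim => a = .ev (endClaim p) ∧ c' = .claimed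
  | .claimed => a = .tau ∧ c' = .beginRelease
  | .beginRelease => a = .ev (beginRelease p) ∧ c' = .dequeue
  | .dequeue => a = .ev (dequeue p) ∧ c' = .linDequeue
  | .linDequeue | .dequeued _ => a = .ev (ret p (some p)) ∧ c' = .repeek
  | .repeek => a = .ev (peek p) ∧ c' = .linRepeek
  | .linRepeek | .repeeked _ => ∃ v, a = .ev (ret p v) ∧ c' = .handOver v
  | .handOver v => ∃ b, a = .ev (casOwner (some p) v b) ∧
      c' = if b = true then v.elim .endRelease .schedule else .endRelease
  | .schedule h => ∃ b, a = .ev (casState h .ENGAGING .SCHEDULED b) ∧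
      c' = if b = true then .scheduled else .reschedule h
  | .reschedule h => ∃ b, a = .ev (casState h .WAITING .SCHEDULED b) ∧ c' = .scheduled
  | .scheduled => a = .tau ∧ c' = .endRelease
  | .endRelease => a = .ev (endRelease p) ∧ c' = .released
  | .released => a = .tau ∧ c' = .idle

/-- A prefix cannot terminate immediately, so the sequel `Q` is not yet reachable. -/
theorem step_seq_pre {E K : Type} {D : K → Proc E K} {e : E} {P Q R : Proc E K} {a : Act E} :
    Step D (seq (e ⇾ P) Q) a R ↔ a = .ev e ∧ R = seq P Q := by
  simp only [step_seq, step_pre]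
  constructor
  · rintro (⟨-, _, ⟨rfl, rfl⟩, rfl⟩ | ⟨-, -, _, h, -⟩)
    · exact ⟨rfl, rfl⟩
    · cases h
  · rintro ⟨rfl, rfl⟩
    exact .inl ⟨by simp, _, ⟨rfl, rfl⟩, rfl⟩

theorem step_seq_input {E K α : Type} {D : K → Proc E K} {c : α → E} {P : α → Proc E K}
    {Q R : Proc E K} {a : Act E} :
    Step D (seq (input c P) Q) a R ↔ ∃ x, a = .ev (c x) ∧ R = seq (P x) Q := by
  simp only [step_seq, step_input]
  constructor
  · rintro (⟨-, _, ⟨x, rfl, rfl⟩, rfl⟩ | ⟨-, -, _, x, h, -⟩)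
    · exact ⟨x, rfl, rfl⟩
    · cases h
  · rintro ⟨x, rfl, rfl⟩
    exact .inl ⟨by simp, _, ⟨x, rfl, rfl⟩, rfl⟩

theorem step_seq_SKIP {E K : Type} {D : K → Proc E K} {Q R : Proc E K} {a : Act E} :
    Step D (seq SKIP Q) a R ↔ a = .tau ∧ R = Q := by
  simp only [step_seq, step_SKIP]
  constructor
  · rintro (⟨h, _, ⟨rfl, -⟩, -⟩ | ⟨rfl, rfl, -⟩)
    · exact absurd rfl h
    · exact ⟨rfl, rfl⟩
  · rintro ⟨rfl, rfl⟩
    exact .inr ⟨rfl, rfl, _, trivial, rfl⟩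

/-- A sequential composition never performs `✓` itself: the `✓` of its first part becomes `τ`. Hence
the outer sequel cannot start in this step. -/
theorem step_seq_seq {E K : Type} {D : K → Proc E K} {P P' Q R : Proc E K} {a : Act E} :
    Step D (seq (seq P P') Q) a R ↔ ∃ S, Step D (seq P P') a S ∧ R = seq S Q := by
  rw [step_seq (P := seq P P')]
  constructor
  · rintro (⟨-, S, h, rfl⟩ | ⟨-, -, S, h⟩)
    · exact ⟨S, h, rfl⟩
    · rcases step_seq.1 h with ⟨h, -⟩ | ⟨h, -⟩
      · exact absurd rfl h
      · cases h
  · rintro ⟨S, h, rfl⟩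
    refine .inl ⟨?_, S, h, rfl⟩
    rintro rfl
    rcases step_seq.1 h with ⟨h, -⟩ | ⟨h, -⟩
    · exact absurd rfl h
    · cases h

theorem step_userTerm {max : ℕ} (p : NonNullPID N) (c : Pc N) (a : Act (Event N)) (R : CProc N) :
    Step (procDefs N max) (userTerm p c) a R ↔ ∃ c', userMove p c a c' ∧ R = userTerm p c' := by
  -- Nearly every control point is a prefix, an input or `SKIP` followed by a sequel; these three
  -- schemes settle them. Only the nested compositions around YIELD and SCHEDULE need separate
  -- treatment.
  have pre_case : ∀ {e P Q c'}, userTerm p c' = seq P Q →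
      (Step (procDefs N max) (seq (e ⇾ P) Q) a R ↔
        ∃ c'', (a = .ev e ∧ c'' = c') ∧ R = userTerm p c'') := by
    rintro e P Q c' h
    rw [step_seq_pre, ← h]
    simp
  have input_case : ∀ {α : Type} {e : α → Event N} {P : α → CProc N} {Q} {c' : α → Pc N},
      (∀ x, userTerm p (c' x) = seq (P x) Q) →
      (Step (procDefs N max) (seq (input e P) Q) a R ↔
        ∃ c'', (∃ x, a = .ev (e x) ∧ c'' = c' x) ∧ R = userTerm p c'') := by
    rintro α e P Q c' h
    rw [step_seq_input]
    simp only [← h]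
    exact ⟨fun ⟨x, h, h'⟩ => ⟨_, ⟨x, h, rfl⟩, h'⟩, fun ⟨_, ⟨x, h, e⟩, h'⟩ => ⟨x, h, e ▸ h'⟩⟩
  have tau_case : ∀ {Q c'}, userTerm p c' = Q →
      (Step (procDefs N max) (seq SKIP Q) a R ↔
        ∃ c'', (a = .tau ∧ c'' = c') ∧ R = userTerm p c'') := by
    rintro Q c' h
    rw [step_seq_SKIP, ← h]
    simp
  cases c with
  | idle =>
    simp only [userTerm]
    rw [step_call]
    exact pre_case rfl
  | engage => exact pre_case rfl
  | enqueue => exact pre_case rfl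
  | linEnqueue => exact pre_case rfl
  | endEnqueue => exact pre_case rfl
  | peek => exact pre_case rfl
  | linPeek => exact input_case fun v => by split_ifs <;> rfl
  | peeked v => exact input_case fun v => by split_ifs <;> rfl
  | casFree => exact input_case fun b => by cases b <;> rfl
  | loadOwner =>
    refine input_case fun v => ?_
    rcases v with _ | o
    · rfl
    · by_cases h : o = p
      · simp [h, userTerm]
      · simp [h, userTerm]
  | storeOwner => exact pre_case rfl
  | casFrom o => exact input_case fun b => by cases b <;> rfl
  | recas => exact input_case fun b => by cases b <;> rfl
  | park => exact input_case fun b => by cases b <;> rfl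
  | await =>
    simp only [userTerm, userMove, YIELD]
    rw [step_seq_seq]
    simp [step_seq_pre, and_assoc]
  | activate =>
    simp only [userTerm, userMove]
    rw [step_seq_seq]
    simp [step_seq_pre, and_assoc]
  | yielded =>
    simp only [userTerm, userMove]
    rw [step_seq_seq]
    simp [step_seq_SKIP, and_assoc]
  | succeed => exact pre_case rfl
  | endClaim => exact pre_case rfl
  | claimed => exact tau_case rfl
  | beginRelease => exact pre_case rfl
  | dequeue => exact pre_case rfl
  | linDequeue => exact pre_case rfl
  | dequeued v => exact pre_case rfl
  | repeek => exact pre_case rfl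
  | linRepeek => exact input_case fun v => rfl
  | repeeked v => exact input_case fun v => rfl
  | handOver v =>
    cases v with
    | none => exact input_case fun b => by cases b <;> rfl
    | some h => exact input_case fun b => by cases b <;> rfl
  | schedule h =>
    simp only [userTerm, userMove, SCHEDULE]
    rw [step_seq_seq]
    simp only [step_seq_input]
    constructor
    · rintro ⟨S, ⟨b, rfl, rfl⟩, rfl⟩
      exact ⟨_, ⟨b, rfl, rfl⟩, by cases b <;> rfl⟩
    · rintro ⟨_, ⟨b, rfl, rfl⟩, rfl⟩
      exact ⟨_, ⟨b, rfl, rfl⟩, by cases b <;> rfl⟩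
  | reschedule h =>
    simp only [userTerm, userMove]
    rw [step_seq_seq]
    simp only [step_seq_input]
    constructor
    · rintro ⟨S, ⟨b, rfl, rfl⟩, rfl⟩
      exact ⟨_, ⟨b, rfl, rfl⟩, rfl⟩
    · rintro ⟨_, ⟨b, rfl, rfl⟩, rfl⟩
      exact ⟨_, ⟨b, rfl, rfl⟩, rfl⟩
  | scheduled =>
    simp only [userTerm, userMove]
    rw [step_seq_seq]
    simp [step_seq_SKIP, and_assoc]
  | endRelease => exact pre_case rfl
  | released => exact tau_case rfl

theorem not_userMove_tick {p : NonNullPID N} {c c' : Pc N} : ¬ userMove p c .tick c' := by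
  cases c <;> simp [userMove]

/-- A state of the whole system. -/
structure State (N : ℕ) where
  pc : NonNullPID N → Pc N
  q : List (NonNullPID N)
  st : NonNullPID N → PState
  own : PID N

namespace State

/-- Move process `p` to the control point `c`. -/
def goto (s : State N) (p : NonNullPID N) (c : Pc N) : State N :=
  { s with pc := Function.update s.pc p c }

def setSt (s : State N) (p : NonNullPID N) (v : PState) : State N :=
  { s with st := Function.update s.st p v }

/-- The only transition of the process `p`, if it is not blocked: its visible event, if any, and
the next state. -/
def next (s : State N) (p : NonNullPID N) : Option (Option (Event N) × State N) :=
  match s.pc p with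
  | .idle => some (some (beginClaim p), s.goto p .engage)
  | .engage => some (none, (s.goto p .enqueue).setSt p .ENGAGING)
  | .enqueue => some (none, s.goto p .linEnqueue)
  | .linEnqueue => some (some (linEnqueue p p), { s.goto p .endEnqueue with q := s.q ++ [p] })
  | .endEnqueue => some (none, s.goto p .peek)
  | .peek => some (none, s.goto p .linPeek)
  | .linPeek => some (none, s.goto p (.peeked s.q.head?))
  | .peeked v => some (none, s.goto p (if v = some p then .casFree else .park))
  | .casFree => some (none, if s.own = none then { s.goto p .succeed with own := some p }
      else s.goto p .loadOwner)
  | .loadOwner => some (none,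
      s.goto p (s.own.elim .storeOwner fun o => if o = p then .park else .casFrom o))
  | .storeOwner => some (none, { s.goto p .succeed with own := some p })
  | .casFrom o => some (none, if s.own = some o then { s.goto p .succeed with own := some p }
      else s.goto p .recas)
  | .recas => some (none, if s.own = none then { s.goto p .succeed with own := some p }
      else s.goto p .park)
  | .park => some (none, if s.st p = .ENGAGING then (s.goto p .await).setSt p .WAITING
      else s.goto p .succeed)
  | .await => if s.st p = .SCHEDULED then some (none, s.goto p .activate) else none
  | .activate => some (none, (s.goto p .yielded).setSt p .ACTIVE)
  | .yielded => some (none, s.goto p .endClaim)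
  | .succeed => some (none, (s.goto p .endClaim).setSt p .ACTIVE)
  | .endClaim => some (some (endClaim p), s.goto p .claimed)
  | .claimed => some (none, s.goto p .beginRelease)
  | .beginRelease => some (none, s.goto p .dequeue)
  | .dequeue => some (none, s.goto p .linDequeue)
  | .linDequeue => some (none, { s.goto p (.dequeued s.q.head?) with q := s.q.tail })
  | .dequeued v => if v = some p then some (none, s.goto p .repeek) else none
  | .repeek => some (none, s.goto p .linRepeek)
  | .linRepeek => some (none, s.goto p (.repeeked s.q.head?))
  | .repeeked v => some (none, s.goto p (.handOver v))
  | .handOver v => some (none,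
      if s.own = some p then { s.goto p (v.elim .endRelease .schedule) with own := v }
      else s.goto p .endRelease)
  | .schedule h => some (none,
      if s.st h = .ENGAGING then (s.goto p .scheduled).setSt h .SCHEDULED
      else s.goto p (.reschedule h))
  | .reschedule h => some (none,
      if s.st h = .WAITING then (s.goto p .scheduled).setSt h .SCHEDULED
      else s.goto p .scheduled)
  | .scheduled => some (none, s.goto p .endRelease)
  | .endRelease => some (none, s.goto p .released)
  | .released => some (none, s.goto p .idle)

/-- The CSP process in the state `s`. -/
def term (s : State N) : CProc N :=
  hide (par DATA (dataTerm (fun p => (s.pc p).queuePc p) s.q s.st s.own)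
    (interAll fun p => userTerm p (s.pc p))) exposedᶜ

def init (N : ℕ) : State N := ⟨fun _ => .idle, [], fun _ => .ACTIVE, none⟩

theorem term_init : (init N).term = FAIR_IMPL N := rfl

end State

/-- The action of the implementation for a visible event, if any. -/
def label (l : Option (Event N)) : Act (Event N) := l.elim .tau .ev

end ClaimRelease

/-! ## The transitions of the implementation -/

namespace ClaimRelease

open Proc Event

variable {N : ℕ}

/-! ### Transitions of the queue and the shared variables, event by event -/

section Data

variable {max : ℕ} [NeZero N] {k : NonNullPID N → QueuePc N} {q : List (NonNullPID N)}
  {st : NonNullPID N → PState} {own : PID N} {R : CProc N}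

theorem step_dataTerm_ev {e : Event N} :
    Step (procDefs N max) (dataTerm k q st own) (.ev e) R ↔
      (∃ p k' q', queueUserMove p (k p) (.ev e) k' ∧ q.length ≤ max ∧ queueSpecMove q e q' ∧
        R = dataTerm (Function.update k p k') q' st own ∧
        ¬ ((∃ p v, e = linDequeue p v) ∨ ∃ p v, e = linPeek p v)) ∨
      (∃ p v, stateMove p (st p) e v ∧ R = dataTerm k q (Function.update st p v) own) ∨
      (∃ v, ownerMove own e v ∧ R = dataTerm k q st v) := by
  rw [step_dataTerm]
  constructor
  · rintro (⟨p, e, k', q', h1, h2, h3, rfl, ⟨-, h⟩ | ⟨h4, h⟩⟩ | ⟨p, e, v, he, h, rfl⟩ |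
      ⟨e, v, he, h, rfl⟩)
    · cases h
    · cases h; exact .inl ⟨p, k', q', h1, h2, h3, rfl, h4⟩
    · cases he; exact .inr (.inl ⟨p, v, h, rfl⟩)
    · cases he; exact .inr (.inr ⟨v, h, rfl⟩)
  · rintro (⟨p, k', q', h1, h2, h3, rfl, h4⟩ | ⟨p, v, h, rfl⟩ | ⟨v, h, rfl⟩)
    · exact .inl ⟨p, e, k', q', h1, h2, h3, rfl, .inr ⟨h4, rfl⟩⟩
    · exact .inr (.inl ⟨p, e, v, rfl, h, rfl⟩)
    · exact .inr (.inr ⟨e, v, rfl, h, rfl⟩)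

theorem step_dataTerm_tau :
    Step (procDefs N max) (dataTerm k q st own) .tau R ↔ q.length ≤ max ∧ ∃ p,
      (k p = .dequeuing ∧
        R = dataTerm (Function.update k p (.returning q.head?)) q.tail st own) ∨
      (k p = .peeking ∧ R = dataTerm (Function.update k p (.returning q.head?)) q st own) := by
  rw [step_dataTerm]
  constructor
  · rintro (⟨p, e, k', q', h1, h2, h3, rfl, ⟨⟨p', v, rfl⟩ | ⟨p', v, rfl⟩, -⟩ | ⟨-, h⟩⟩ |
      ⟨p, e, v, h, -⟩ | ⟨e, v, h, -⟩)
    · obtain ⟨rfl, rfl⟩ := h3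
      refine ⟨h2, p, .inl ?_⟩
      cases hk : k p <;> simp [hk, queueUserMove] at h1
      simp [h1]
    · obtain ⟨rfl, rfl⟩ := h3
      refine ⟨h2, p, .inr ?_⟩
      cases hk : k p <;> simp [hk, queueUserMove] at h1
      simp [h1]
    · cases h
    · cases h
    · cases h
  · rintro ⟨h, p, ⟨hk, rfl⟩ | ⟨hk, rfl⟩⟩
    · exact .inl ⟨p, linDequeue p q.head?, .returning q.head?, q.tail, by simp [hk, queueUserMove],
        h, ⟨rfl, rfl⟩, rfl, by simp⟩
    · exact .inl ⟨p, linPeek p q.head?, .returning q.head?, q, by simp [hk, queueUserMove],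
        h, ⟨rfl, rfl⟩, rfl, by simp⟩

/-- Indexed by the event instead of the control point: a given event then determines which component
performs it, and `simp` discards the others. -/
theorem queueUserMove_ev_iff {p : NonNullPID N} {k k' : QueuePc N} {e : Event N} :
    queueUserMove p k (.ev e) k' ↔
      match e with
      | enqueue p' v => p' = p ∧ k = .idle ∧ k' = .enqueuing v
      | endEnqueue p' => p' = p ∧ k = .enqueued ∧ k' = .idle
      | dequeue p' => p' = p ∧ k = .idle ∧ k' = .dequeuing
      | peek p' => p' = p ∧ k = .idle ∧ k' = .peeking
      | ret p' v => p' = p ∧ k = .returning v ∧ k' = .idle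
      | linEnqueue p' v => p' = p ∧ k = .enqueuing v ∧ k' = .enqueued
      | linDequeue p' v => p' = p ∧ k = .dequeuing ∧ k' = .returning v
      | linPeek p' v => p' = p ∧ k = .peeking ∧ k' = .returning v
      | _ => False := by
  cases k <;> cases e <;> simp [queueUserMove] <;> grind

theorem step_dataTerm_owner_load {v : PID N} :
    Step (procDefs N max) (dataTerm k q st own) (.ev (owner .load v)) R ↔
      v = own ∧ R = dataTerm k q st own := by
  simp [step_dataTerm_ev, queueUserMove_ev_iff, stateMove, ownerMove, and_assoc]

theorem step_dataTerm_owner_store {v : PID N} :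
    Step (procDefs N max) (dataTerm k q st own) (.ev (owner .store v)) R ↔
      R = dataTerm k q st v := by
  simp [step_dataTerm_ev, queueUserMove_ev_iff, stateMove, ownerMove]

theorem step_dataTerm_casOwner {x y : PID N} {b : Bool} :
    Step (procDefs N max) (dataTerm k q st own) (.ev (casOwner x y b)) R ↔
      b = decide (x = own) ∧ R = dataTerm k q st (if x = own then y else own) := by
  simp [step_dataTerm_ev, queueUserMove_ev_iff, stateMove, ownerMove, and_assoc]

theorem step_dataTerm_state_load {p : NonNullPID N} {v : PState} :
    Step (procDefs N max) (dataTerm k q st own) (.ev (state .load p v)) R ↔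
      v = st p ∧ R = dataTerm k q st own := by
  simp only [step_dataTerm_ev, queueUserMove_ev_iff, stateMove, ownerMove]
  simp

theorem step_dataTerm_state_store {p : NonNullPID N} {v : PState} :
    Step (procDefs N max) (dataTerm k q st own) (.ev (state .store p v)) R ↔
      R = dataTerm k q (Function.update st p v) own := by
  simp [step_dataTerm_ev, queueUserMove_ev_iff, stateMove, ownerMove, and_assoc]

theorem step_dataTerm_casState {p : NonNullPID N} {x y : PState} {b : Bool} :
    Step (procDefs N max) (dataTerm k q st own) (.ev (casState p x y b)) R ↔
      b = decide (x = st p) ∧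
        R = dataTerm k q (if x = st p then Function.update st p y else st) own := by
  simp only [step_dataTerm_ev, queueUserMove_ev_iff, stateMove, ownerMove]
  split_ifs <;> simp [*]

theorem step_dataTerm_enqueue {p v : NonNullPID N} :
    Step (procDefs N max) (dataTerm k q st own) (.ev (enqueue p v)) R ↔
      k p = .idle ∧ q.length ≤ max ∧
        R = dataTerm (Function.update k p (.enqueuing v)) q st own := by
  simp [step_dataTerm_ev, queueUserMove_ev_iff, stateMove, ownerMove, and_assoc, queueSpecMove]

theorem step_dataTerm_endEnqueue {p : NonNullPID N} :
    Step (procDefs N max) (dataTerm k q st own) (.ev (endEnqueue p)) R ↔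
      k p = .enqueued ∧ q.length ≤ max ∧
        R = dataTerm (Function.update k p .idle) q st own := by
  simp [step_dataTerm_ev, queueUserMove_ev_iff, stateMove, ownerMove, and_assoc, queueSpecMove]

theorem step_dataTerm_dequeue {p : NonNullPID N} :
    Step (procDefs N max) (dataTerm k q st own) (.ev (dequeue p)) R ↔
      k p = .idle ∧ q.length ≤ max ∧
        R = dataTerm (Function.update k p .dequeuing) q st own := by
  simp [step_dataTerm_ev, queueUserMove_ev_iff, stateMove, ownerMove, and_assoc, queueSpecMove]

theorem step_dataTerm_peek {p : NonNullPID N} :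
    Step (procDefs N max) (dataTerm k q st own) (.ev (peek p)) R ↔
      k p = .idle ∧ q.length ≤ max ∧
        R = dataTerm (Function.update k p .peeking) q st own := by
  simp [step_dataTerm_ev, queueUserMove_ev_iff, stateMove, ownerMove, and_assoc, queueSpecMove]

theorem step_dataTerm_ret {p : NonNullPID N} {v : PID N} :
    Step (procDefs N max) (dataTerm k q st own) (.ev (ret p v)) R ↔
      k p = .returning v ∧ q.length ≤ max ∧
        R = dataTerm (Function.update k p .idle) q st own := by
  simp [step_dataTerm_ev, queueUserMove_ev_iff, stateMove, ownerMove, and_assoc, queueSpecMove]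

theorem step_dataTerm_linEnqueue {p v : NonNullPID N} :
    Step (procDefs N max) (dataTerm k q st own) (.ev (linEnqueue p v)) R ↔
      k p = .enqueuing v ∧ q.length ≤ max ∧
        R = dataTerm (Function.update k p .enqueued) (q ++ [v]) st own := by
  simp [step_dataTerm_ev, queueUserMove_ev_iff, stateMove, ownerMove, and_assoc, queueSpecMove]

theorem not_step_dataTerm_tick : ¬ Step (procDefs N max) (dataTerm k q st own) .tick R := by
  simp [step_dataTerm]

end Data

section Users

variable {max : ℕ} [NeZero N] {c : NonNullPID N → Pc N} {R : CProc N} {a : Act (Event N)}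

theorem step_users :
    Step (procDefs N max) (interAll fun p => userTerm p (c p)) a R ↔
      ∃ p c', userMove p (c p) a c' ∧
        R = interAll fun j => userTerm j (Function.update c p c' j) :=
  step_interAll_family step_userTerm (fun _ _ _ => not_userMove_tick)
    (fun p c => by cases c <;> simp [userTerm, releaseThenLoop])

theorem not_step_users_tick :
    ¬ Step (procDefs N max) (interAll fun p => userTerm p (c p)) .tick R := by
  simp [step_users, not_userMove_tick]

end Users

end ClaimRelease

/-! ### The transitions of the implementation are those given by `next` -/

namespace ClaimRelease

open Proc Event

variable {N : ℕ}

/-- What is seen of the event `e` of the system. -/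
noncomputable def conceal (e : Event N) : Act (Event N) :=
  open Classical in if e ∈ exposed then .ev e else .tau

theorem mem_DATA {e : Event N} : e ∈ DATA ↔
    match e with
    | linEnqueue _ _ | linDequeue _ _ | linPeek _ _ | beginClaim _ | endClaim _ | beginRelease _
    | endRelease _ => False
    | _ => True := by
  rcases e with _ | ⟨_, _, _ | _⟩ | _ | ⟨_, _, _, _ | _⟩ | _ | _ | _ | _ | _ | _ | _ | _ | _ | _ |
    _ | _ <;> simp [DATA, queueAlpha]

theorem mem_exposed {e : Event N} : e ∈ exposed ↔
    match e with
    | linEnqueue _ _ | beginClaim _ | endClaim _ => True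
    | _ => False := by
  cases e <;> simp [exposed]

theorem conceal_of_mem_DATA {e : Event N} (he : e ∈ DATA) : conceal e = .tau := by
  rw [conceal, if_neg]
  cases e <;> simp [mem_DATA, mem_exposed] at he ⊢

namespace State

section Step

variable {max : ℕ} {s : State N} {p : NonNullPID N} {c c' : Pc N} {k' : QueuePc N}
  {q : List (NonNullPID N)} {st : NonNullPID N → PState} {own : PID N} {R D' : CProc N}
  {a : Act (Event N)} {e : Event N}

/-- This and the next two lemmas recognise the successor term as a `State.term`, according to which
half of a merged control point moves: the user alone, the user together with the queue, or the queue
alone. The half that stays put must have the same term at both control points. -/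
theorem term_of_user (h : (s.pc p).queuePc p = c'.queuePc p) :
    hide (par DATA (dataTerm (fun j => (s.pc j).queuePc j) q st own)
      (interAll fun j => userTerm j (Function.update s.pc p c' j))) exposedᶜ =
    term ⟨Function.update s.pc p c', q, st, own⟩ := by
  have : (fun j => (s.pc j).queuePc j) = fun j => (Function.update s.pc p c' j).queuePc j := by
    funext j
    rcases eq_or_ne j p with rfl | hj
    · simpa using h
    · simp [hj]
  rw [this, term]

theorem term_of_update (h : k' = c'.queuePc p) :
    hide (par DATA (dataTerm (Function.update (fun j => (s.pc j).queuePc j) p k') q st own)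
      (interAll fun j => userTerm j (Function.update s.pc p c' j))) exposedᶜ =
    term ⟨Function.update s.pc p c', q, st, own⟩ := by
  have : Function.update (fun j => (s.pc j).queuePc j) p k' =
      fun j => (Function.update s.pc p c' j).queuePc j := by
    funext j
    rcases eq_or_ne j p with rfl | hj
    · simpa using h
    · simp [hj]
  rw [this, term]

theorem term_of_queue (h : k' = c'.queuePc p) (hu : userTerm p (s.pc p) = userTerm p c') :
    hide (par DATA (dataTerm (Function.update (fun j => (s.pc j).queuePc j) p k') q st own)
      (interAll fun j => userTerm j (s.pc j))) exposedᶜ =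
    term ⟨Function.update s.pc p c', q, st, own⟩ := by
  have : (fun j => userTerm j (s.pc j)) = fun j => userTerm j (Function.update s.pc p c' j) := by
    funext j
    rcases eq_or_ne j p with rfl | hj
    · simpa using hu
    · simp [hj]
  rw [this, term_of_update h]

variable [NeZero N]

/-- Transitions of the implementation in terms of its components. -/
theorem step_term_iff : Step (procDefs N max) s.term a R ↔
    (∃ D', a = .tau ∧ Step (procDefs N max)
        (dataTerm (fun j => (s.pc j).queuePc j) s.q s.st s.own) .tau D' ∧
      R = hide (par DATA D' (interAll fun j => userTerm j (s.pc j))) exposedᶜ) ∨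
    (∃ e ∉ DATA, ∃ D', a = conceal e ∧ Step (procDefs N max)
        (dataTerm (fun j => (s.pc j).queuePc j) s.q s.st s.own) (.ev e) D' ∧
      R = hide (par DATA D' (interAll fun j => userTerm j (s.pc j))) exposedᶜ) ∨
    (∃ p c', a = .tau ∧ userMove p (s.pc p) .tau c' ∧
      R = hide (par DATA (dataTerm (fun j => (s.pc j).queuePc j) s.q s.st s.own)
        (interAll fun j => userTerm j (Function.update s.pc p c' j))) exposedᶜ) ∨
    (∃ e ∉ DATA, ∃ p c', a = conceal e ∧
      userMove p (s.pc p) (.ev e) c' ∧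
      R = hide (par DATA (dataTerm (fun j => (s.pc j).queuePc j) s.q s.st s.own)
        (interAll fun j => userTerm j (Function.update s.pc p c' j))) exposedᶜ) ∨
    (∃ e ∈ DATA, ∃ D' p c', a = conceal e ∧ Step (procDefs N max)
        (dataTerm (fun j => (s.pc j).queuePc j) s.q s.st s.own) (.ev e) D' ∧
      userMove p (s.pc p) (.ev e) c' ∧
      R = hide (par DATA D'
        (interAll fun j => userTerm j (Function.update s.pc p c' j))) exposedᶜ) := by
  have inner := fun b S => step_par (D := procDefs N max) (A := DATA) (a := b) (R := S)
    (P := dataTerm (fun j => (s.pc j).queuePc j) s.q s.st s.own)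
    (Q := interAll fun j => userTerm j (s.pc j))
    (fun _ => not_step_dataTerm_tick) (fun _ => not_step_users_tick) (by simp [dataTerm, inter])
  have vis : ∀ e : Event N, (e ∈ exposedᶜ ∧ a = .tau ∨ e ∉ exposedᶜ ∧ a = .ev e) ↔
      a = conceal e := fun e => by
    by_cases h : e ∈ exposed <;> simp [h, conceal]
  unfold term
  rw [step_hide (by simp [inner, not_step_dataTerm_tick, not_step_users_tick])]
  simp only [vis, inner, step_users]
  constructor
  · rintro ⟨P', rfl, ⟨rfl, ⟨D', -, h, rfl⟩ | ⟨U', -, ⟨p, c', h, rfl⟩, rfl⟩ | ⟨e, -, _, _, h, -⟩⟩ |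
      ⟨e, ⟨D', h | ⟨e', he, h⟩, h', rfl⟩ | ⟨U', h | ⟨e', he, h⟩, ⟨p, c', h', rfl⟩, rfl⟩ |
        ⟨e', he, D', U', h, hd, ⟨p, c', hu, rfl⟩, rfl⟩, ha⟩⟩
    · exact .inl ⟨D', rfl, h, rfl⟩
    · exact .inr (.inr (.inl ⟨p, c', rfl, h, rfl⟩))
    · cases h
    · cases h
    · cases h; exact .inr (.inl ⟨e, he, D', ha, h', rfl⟩)
    · cases h
    · cases h; exact .inr (.inr (.inr (.inl ⟨e, he, p, c', ha, h', rfl⟩)))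
    · cases h; exact .inr (.inr (.inr (.inr ⟨e, he, D', p, c', ha, hd, hu, rfl⟩)))
  · rintro (⟨D', rfl, h, rfl⟩ | ⟨e, he, D', ha, h, rfl⟩ | ⟨p, c', rfl, h, rfl⟩ |
      ⟨e, he, p, c', ha, h, rfl⟩ | ⟨e, he, D', p, c', ha, hd, hu, rfl⟩)
    · exact ⟨_, rfl, .inl ⟨rfl, .inl ⟨D', .inl trivial, h, rfl⟩⟩⟩
    · exact ⟨_, rfl, .inr ⟨e, .inl ⟨D', .inr ⟨e, he, rfl⟩, h, rfl⟩, ha⟩⟩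
    · exact ⟨_, rfl, .inl ⟨rfl, .inr (.inl ⟨_, .inl trivial, ⟨p, c', h, rfl⟩, rfl⟩)⟩⟩
    · exact ⟨_, rfl, .inr ⟨e, .inr (.inl ⟨_, .inr ⟨e, he, rfl⟩, ⟨p, c', h, rfl⟩, rfl⟩), ha⟩⟩
    · exact ⟨_, rfl, .inr ⟨e, .inr (.inr ⟨e, he, D', _, rfl, hd, ⟨p, c', hu, rfl⟩, rfl⟩), ha⟩⟩

/-- A synchronisation of a user with its data is the transition `next`. -/
theorem next_of_sync (hd : Step (procDefs N max)
      (dataTerm (fun j => (s.pc j).queuePc j) s.q s.st s.own) (.ev e) D')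
    (hu : userMove p (s.pc p) (.ev e) c') (he : e ∈ DATA) :
    ∃ s', s.next p = some (none, s') ∧ hide (par DATA D'
      (interAll fun j => userTerm j (Function.update s.pc p c' j))) exposedᶜ = s'.term := by
  cases hc : s.pc p <;> simp only [hc, userMove] at hu
  case idle => obtain ⟨⟨⟩, rfl⟩ := hu; simp [mem_DATA] at he
  case engage =>
    obtain ⟨⟨⟩, rfl⟩ := hu
    rw [step_dataTerm_state_store] at hd
    subst hd
    exact ⟨_, by simp only [next, hc]; rfl, term_of_user (by simp [hc, Pc.queuePc])⟩
  case enqueue =>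
    obtain ⟨⟨⟩, rfl⟩ := hu
    rw [step_dataTerm_enqueue] at hd
    obtain ⟨-, -, rfl⟩ := hd
    exact ⟨_, by simp only [next, hc]; rfl, term_of_update rfl⟩
  -- The user is already waiting for `endEnqueue`, but its queue part has yet to commit, so there is
  -- no synchronisation. The cases `linPeek`, `linDequeue` and `linRepeek` are excluded in the same
  -- way.
  case linEnqueue =>
    obtain ⟨⟨⟩, rfl⟩ := hu
    rw [step_dataTerm_endEnqueue] at hd
    simp [hc, Pc.queuePc] at hd
  case endEnqueue =>
    obtain ⟨⟨⟩, rfl⟩ := hu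
    rw [step_dataTerm_endEnqueue] at hd
    obtain ⟨-, -, rfl⟩ := hd
    exact ⟨_, by simp only [next, hc]; rfl, term_of_update rfl⟩
  case peek =>
    obtain ⟨⟨⟩, rfl⟩ := hu
    rw [step_dataTerm_peek] at hd
    obtain ⟨-, -, rfl⟩ := hd
    exact ⟨_, by simp only [next, hc]; rfl, term_of_update rfl⟩
  case linPeek =>
    obtain ⟨v, ⟨⟩, rfl⟩ := hu
    rw [step_dataTerm_ret] at hd
    simp [hc, Pc.queuePc] at hd
  case peeked v =>
    obtain ⟨v', ⟨⟩, rfl⟩ := hu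
    rw [step_dataTerm_ret] at hd
    obtain ⟨h, -, rfl⟩ := hd
    simp only [hc, Pc.queuePc, QueuePc.returning.injEq] at h
    subst h
    exact ⟨_, by simp only [next, hc]; rfl, term_of_update (by split_ifs <;> rfl)⟩
  case casFree =>
    obtain ⟨b, ⟨⟩, rfl⟩ := hu
    rw [step_dataTerm_casOwner] at hd
    obtain ⟨rfl, rfl⟩ := hd
    by_cases h : s.own = none
    · simp only [next, hc, h]
      exact ⟨_, rfl, term_of_user (by simp [hc, Pc.queuePc])⟩
    · simp only [next, hc, h, Ne.symm h]
      exact ⟨_, rfl, term_of_user (by simp [hc, Pc.queuePc])⟩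
  case loadOwner =>
    obtain ⟨v, ⟨⟩, rfl⟩ := hu
    rw [step_dataTerm_owner_load] at hd
    obtain ⟨rfl, rfl⟩ := hd
    simp only [next, hc]
    refine ⟨_, rfl, term_of_user ?_⟩
    rw [hc]
    cases s.own with
    | none => rfl
    | some o => by_cases h : o = p <;> simp [h, Pc.queuePc]
  case storeOwner =>
    obtain ⟨⟨⟩, rfl⟩ := hu
    rw [step_dataTerm_owner_store] at hd
    subst hd
    exact ⟨_, by simp only [next, hc]; rfl, term_of_user (by simp [hc, Pc.queuePc])⟩
  case casFrom o =>
    obtain ⟨b, ⟨⟩, rfl⟩ := hu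
    rw [step_dataTerm_casOwner] at hd
    obtain ⟨rfl, rfl⟩ := hd
    by_cases h : s.own = some o
    · simp only [next, hc, h]
      exact ⟨_, rfl, term_of_user (by simp [hc, Pc.queuePc])⟩
    · simp only [next, hc, h, Ne.symm h]
      exact ⟨_, rfl, term_of_user (by simp [hc, Pc.queuePc])⟩
  case recas =>
    obtain ⟨b, ⟨⟩, rfl⟩ := hu
    rw [step_dataTerm_casOwner] at hd
    obtain ⟨rfl, rfl⟩ := hd
    by_cases h : s.own = none
    · simp only [next, hc, h]
      exact ⟨_, rfl, term_of_user (by simp [hc, Pc.queuePc])⟩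
    · simp only [next, hc, h, Ne.symm h]
      exact ⟨_, rfl, term_of_user (by simp [hc, Pc.queuePc])⟩
  case park =>
    obtain ⟨b, ⟨⟩, rfl⟩ := hu
    rw [step_dataTerm_casState] at hd
    obtain ⟨rfl, rfl⟩ := hd
    by_cases h : s.st p = .ENGAGING
    · simp only [next, hc, h]
      exact ⟨_, rfl, term_of_user (by simp [hc, Pc.queuePc])⟩
    · simp only [next, hc, h, Ne.symm h]
      exact ⟨_, rfl, term_of_user (by simp [hc, Pc.queuePc])⟩
  case await =>
    obtain ⟨⟨⟩, rfl⟩ := hu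
    rw [step_dataTerm_state_load] at hd
    obtain ⟨h, rfl⟩ := hd
    simp only [next, hc, ← h]
    exact ⟨_, rfl, term_of_user (by simp [hc, Pc.queuePc])⟩
  case activate =>
    obtain ⟨⟨⟩, rfl⟩ := hu
    rw [step_dataTerm_state_store] at hd
    subst hd
    exact ⟨_, by simp only [next, hc]; rfl, term_of_user (by simp [hc, Pc.queuePc])⟩
  case yielded => obtain ⟨⟨⟩, rfl⟩ := hu
  case succeed =>
    obtain ⟨⟨⟩, rfl⟩ := hu
    rw [step_dataTerm_state_store] at hd
    subst hd
    exact ⟨_, by simp only [next, hc]; rfl, term_of_user (by simp [hc, Pc.queuePc])⟩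
  case endClaim => obtain ⟨⟨⟩, rfl⟩ := hu; simp [mem_DATA] at he
  case claimed => obtain ⟨⟨⟩, rfl⟩ := hu
  case beginRelease => obtain ⟨⟨⟩, rfl⟩ := hu; simp [mem_DATA] at he
  case dequeue =>
    obtain ⟨⟨⟩, rfl⟩ := hu
    rw [step_dataTerm_dequeue] at hd
    obtain ⟨-, -, rfl⟩ := hd
    exact ⟨_, by simp only [next, hc]; rfl, term_of_update rfl⟩
  case linDequeue =>
    obtain ⟨⟨⟩, rfl⟩ := hu
    rw [step_dataTerm_ret] at hd
    simp [hc, Pc.queuePc] at hd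
  case dequeued v =>
    obtain ⟨⟨⟩, rfl⟩ := hu
    rw [step_dataTerm_ret] at hd
    obtain ⟨h, -, rfl⟩ := hd
    simp only [hc, Pc.queuePc, QueuePc.returning.injEq] at h
    simp only [next, hc, h]
    exact ⟨_, rfl, term_of_update rfl⟩
  case repeek =>
    obtain ⟨⟨⟩, rfl⟩ := hu
    rw [step_dataTerm_peek] at hd
    obtain ⟨-, -, rfl⟩ := hd
    exact ⟨_, by simp only [next, hc]; rfl, term_of_update rfl⟩
  case linRepeek =>
    obtain ⟨v, ⟨⟩, rfl⟩ := hu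
    rw [step_dataTerm_ret] at hd
    simp [hc, Pc.queuePc] at hd
  case repeeked v =>
    obtain ⟨v', ⟨⟩, rfl⟩ := hu
    rw [step_dataTerm_ret] at hd
    obtain ⟨h, -, rfl⟩ := hd
    simp only [hc, Pc.queuePc, QueuePc.returning.injEq] at h
    subst h
    exact ⟨_, by simp only [next, hc]; rfl, term_of_update rfl⟩
  case handOver v =>
    obtain ⟨b, ⟨⟩, rfl⟩ := hu
    rw [step_dataTerm_casOwner] at hd
    obtain ⟨rfl, rfl⟩ := hd
    by_cases h : s.own = some p
    · simp only [next, hc, h]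
      exact ⟨_, rfl, term_of_user (by cases v <;> simp [hc, Pc.queuePc])⟩
    · simp only [next, hc, h, Ne.symm h]
      exact ⟨_, rfl, term_of_user (by simp [hc, Pc.queuePc])⟩
  case schedule r =>
    obtain ⟨b, ⟨⟩, rfl⟩ := hu
    rw [step_dataTerm_casState] at hd
    obtain ⟨rfl, rfl⟩ := hd
    by_cases h : s.st r = .ENGAGING
    · simp only [next, hc, h]
      exact ⟨_, rfl, term_of_user (by simp [hc, Pc.queuePc])⟩
    · simp only [next, hc, h, Ne.symm h]
      exact ⟨_, rfl, term_of_user (by simp [hc, Pc.queuePc])⟩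
  case reschedule r =>
    obtain ⟨b, ⟨⟩, rfl⟩ := hu
    rw [step_dataTerm_casState] at hd
    obtain ⟨rfl, rfl⟩ := hd
    by_cases h : s.st r = .WAITING
    · simp only [next, hc, h]
      exact ⟨_, rfl, term_of_user (by simp [hc, Pc.queuePc])⟩
    · simp only [next, hc, h, Ne.symm h]
      exact ⟨_, rfl, term_of_user (by simp [hc, Pc.queuePc])⟩
  case scheduled => obtain ⟨⟨⟩, rfl⟩ := hu
  case endRelease => obtain ⟨⟨⟩, rfl⟩ := hu; simp [mem_DATA] at he
  case released => obtain ⟨⟨⟩, rfl⟩ := hu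

/-- Every transition of the implementation is the transition `next` of some process. -/
theorem exists_next_of_step (h : Step (procDefs N max) s.term a R) :
    ∃ p l s', s.next p = some (l, s') ∧ a = label l ∧ R = s'.term := by
  rcases step_term_iff.1 h with ⟨D', rfl, hd, rfl⟩ | ⟨e, he, D', rfl, hd, rfl⟩ |
    ⟨p, c', rfl, hu, rfl⟩ | ⟨e, he, p, c', rfl, hu, rfl⟩ | ⟨e, he, D', p, c', rfl, hd, hu, rfl⟩
  -- An internal action of the data commits a dequeue or a peek; a peek is pending both at `linPeek`
  -- and at `linRepeek`.
  · rw [step_dataTerm_tau] at hd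
    obtain ⟨-, p, ⟨hk, rfl⟩ | ⟨hk, rfl⟩⟩ := hd
    · cases hc : s.pc p <;> simp [hc, Pc.queuePc] at hk
      exact ⟨p, none, _, by simp only [next, hc]; rfl, rfl, term_of_queue rfl (by rw [hc]; rfl)⟩
    · cases hc : s.pc p <;> simp [hc, Pc.queuePc] at hk
      · exact ⟨p, none, _, by simp only [next, hc]; rfl, rfl, term_of_queue rfl (by rw [hc]; rfl)⟩
      · exact ⟨p, none, _, by simp only [next, hc]; rfl, rfl, term_of_queue rfl (by rw [hc]; rfl)⟩
  -- The commits of dequeue and peek are concealed inside the queue, so `linEnqueue` is the only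
  -- event of the data in which the users take no part.
  · have : ∃ p v, e = linEnqueue p v := by
      rw [step_dataTerm_ev] at hd
      cases e <;> simp [mem_DATA] at he <;>
        simp [queueUserMove_ev_iff, stateMove, ownerMove] at hd ⊢
    obtain ⟨p, v, rfl⟩ := this
    rw [step_dataTerm_linEnqueue] at hd
    obtain ⟨hk, -, rfl⟩ := hd
    cases hc : s.pc p <;> simp [hc, Pc.queuePc] at hk
    subst hk
    exact ⟨p, some (linEnqueue p p), _, by simp only [next, hc]; rfl, by simp [conceal, mem_exposed, label],
      term_of_queue rfl (by rw [hc]; rfl)⟩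
  · cases hc : s.pc p <;> simp [hc, userMove] at hu <;> subst hu <;>
      exact ⟨p, none, _, by simp only [next, hc]; rfl, rfl, term_of_user (by simp [hc, Pc.queuePc])⟩
  · cases hc : s.pc p <;> simp only [hc, userMove] at hu
    case idle =>
      obtain ⟨⟨⟩, rfl⟩ := hu
      exact ⟨p, some (beginClaim p), _, by simp only [next, hc]; rfl, by simp [conceal, mem_exposed, label],
        term_of_user (by simp [hc, Pc.queuePc])⟩
    case endClaim =>
      obtain ⟨⟨⟩, rfl⟩ := hu
      exact ⟨p, some (endClaim p), _, by simp only [next, hc]; rfl, by simp [conceal, mem_exposed, label],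
        term_of_user (by simp [hc, Pc.queuePc])⟩
    case beginRelease =>
      obtain ⟨⟨⟩, rfl⟩ := hu
      exact ⟨p, none, _, by simp only [next, hc]; rfl, by simp [conceal, mem_exposed, label],
        term_of_user (by simp [hc, Pc.queuePc])⟩
    case endRelease =>
      obtain ⟨⟨⟩, rfl⟩ := hu
      exact ⟨p, none, _, by simp only [next, hc]; rfl, by simp [conceal, mem_exposed, label],
        term_of_user (by simp [hc, Pc.queuePc])⟩
    all_goals
      exfalso
      first
        | (obtain ⟨⟨⟩, -⟩ := hu; simp [mem_DATA] at he; done)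
        | (obtain ⟨_, ⟨⟩, -⟩ := hu; simp [mem_DATA] at he; done)
        | simp at hu
  · obtain ⟨s', h, h'⟩ := next_of_sync hd hu he
    exact ⟨p, none, s', h, conceal_of_mem_DATA he, h'⟩

/-- As long as the queue is not over its bound, `next` is possible in the implementation. -/
theorem step_of_next {l : Option (Event N)} {s' : State N} (hq : s.q.length ≤ max)
    (h : s.next p = some (l, s')) : ∃ R, Step (procDefs N max) s.term (label l) R := by
  have sync : ∀ e D' c', userMove p (s.pc p) (.ev e) c' → Step (procDefs N max)
      (dataTerm (fun j => (s.pc j).queuePc j) s.q s.st s.own) (.ev e) D' →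
      e ∈ DATA → ∃ R, Step (procDefs N max) s.term .tau R :=
    fun e D' c' hu hd he => ⟨_, step_term_iff.2
      (.inr (.inr (.inr (.inr ⟨e, he, D', p, c', (conceal_of_mem_DATA he).symm, hd, hu, rfl⟩))))⟩
  have user : ∀ c', userMove p (s.pc p) .tau c' →
      ∃ R, Step (procDefs N max) s.term .tau R :=
    fun c' hu => ⟨_, step_term_iff.2 (.inr (.inr (.inl ⟨p, c', rfl, hu, rfl⟩)))⟩
  have queue : ∀ D', Step (procDefs N max)
      (dataTerm (fun j => (s.pc j).queuePc j) s.q s.st s.own) .tau D' →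
      ∃ R, Step (procDefs N max) s.term .tau R :=
    fun D' hd => ⟨_, step_term_iff.2 (.inl ⟨D', rfl, hd, rfl⟩)⟩
  have event : ∀ e c', e ∉ DATA → userMove p (s.pc p) (.ev e) c' →
      ∃ R, Step (procDefs N max) s.term (conceal e) R :=
    fun e c' he hu => ⟨_, step_term_iff.2 (.inr (.inr (.inr (.inl ⟨e, he, p, c', rfl, hu, rfl⟩))))⟩
  cases hc : s.pc p <;> simp only [next, hc] at h
  -- `await` and `dequeued` are the only control points at which `next` may be undefined; the guard
  -- is exactly what the synchronisation needs.
  case await =>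
    split_ifs at h with h'
    cases h
    exact sync _ _ _ (by rw [hc]; exact ⟨rfl, rfl⟩)
      (step_dataTerm_state_load.2 ⟨h'.symm, rfl⟩) (by simp [mem_DATA])
  case dequeued v =>
    split_ifs at h with h'
    cases h
    subst h'
    exact sync _ _ _ (by rw [hc]; exact ⟨rfl, rfl⟩)
      (step_dataTerm_ret.2 ⟨by simp [hc, Pc.queuePc], hq, rfl⟩) (by simp [mem_DATA])
  all_goals
    obtain ⟨rfl, -⟩ := Prod.mk.inj (Option.some.inj h)
    clear h
  case idle =>
    simpa [conceal, mem_exposed, label] using event (beginClaim p) .engage (by simp [mem_DATA])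
      (by rw [hc]; exact ⟨rfl, rfl⟩)
  case endClaim =>
    simpa [conceal, mem_exposed, label] using event (endClaim p) .claimed (by simp [mem_DATA])
      (by rw [hc]; exact ⟨rfl, rfl⟩)
  case beginRelease =>
    simpa [conceal, mem_exposed, label] using event (beginRelease p) .dequeue (by simp [mem_DATA])
      (by rw [hc]; exact ⟨rfl, rfl⟩)
  case endRelease =>
    simpa [conceal, mem_exposed, label] using event (endRelease p) .released (by simp [mem_DATA])
      (by rw [hc]; exact ⟨rfl, rfl⟩)
  case linEnqueue =>
    exact ⟨_, step_term_iff.2 (.inr (.inl ⟨linEnqueue p p, by simp [mem_DATA], _,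
      by simp [conceal, mem_exposed, label], step_dataTerm_linEnqueue.2 ⟨by simp [hc, Pc.queuePc], hq, rfl⟩,
      rfl⟩))⟩
  case linPeek =>
    exact queue _ (step_dataTerm_tau.2 ⟨hq, p, .inr ⟨by simp [hc, Pc.queuePc], rfl⟩⟩)
  case linRepeek =>
    exact queue _ (step_dataTerm_tau.2 ⟨hq, p, .inr ⟨by simp [hc, Pc.queuePc], rfl⟩⟩)
  case linDequeue =>
    exact queue _ (step_dataTerm_tau.2 ⟨hq, p, .inl ⟨by simp [hc, Pc.queuePc], rfl⟩⟩)
  case yielded => exact user _ (by rw [hc]; exact ⟨rfl, rfl⟩)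
  case claimed => exact user _ (by rw [hc]; exact ⟨rfl, rfl⟩)
  case scheduled => exact user _ (by rw [hc]; exact ⟨rfl, rfl⟩)
  case released => exact user _ (by rw [hc]; exact ⟨rfl, rfl⟩)
  case engage =>
    exact sync _ _ _ (by rw [hc]; exact ⟨rfl, rfl⟩)
      (step_dataTerm_state_store.2 rfl) (by simp [mem_DATA])
  case activate =>
    exact sync _ _ _ (by rw [hc]; exact ⟨rfl, rfl⟩)
      (step_dataTerm_state_store.2 rfl) (by simp [mem_DATA])
  case succeed =>
    exact sync _ _ _ (by rw [hc]; exact ⟨rfl, rfl⟩)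
      (step_dataTerm_state_store.2 rfl) (by simp [mem_DATA])
  case storeOwner =>
    exact sync _ _ _ (by rw [hc]; exact ⟨rfl, rfl⟩)
      (step_dataTerm_owner_store.2 rfl) (by simp [mem_DATA])
  case loadOwner =>
    exact sync _ _ _ (by rw [hc]; exact ⟨_, rfl, rfl⟩)
      (step_dataTerm_owner_load.2 ⟨rfl, rfl⟩) (by simp [mem_DATA])
  case enqueue =>
    exact sync _ _ _ (by rw [hc]; exact ⟨rfl, rfl⟩)
      (step_dataTerm_enqueue.2 ⟨by simp [hc, Pc.queuePc], hq, rfl⟩) (by simp [mem_DATA])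
  case endEnqueue =>
    exact sync _ _ _ (by rw [hc]; exact ⟨rfl, rfl⟩)
      (step_dataTerm_endEnqueue.2 ⟨by simp [hc, Pc.queuePc], hq, rfl⟩) (by simp [mem_DATA])
  case peek =>
    exact sync _ _ _ (by rw [hc]; exact ⟨rfl, rfl⟩)
      (step_dataTerm_peek.2 ⟨by simp [hc, Pc.queuePc], hq, rfl⟩) (by simp [mem_DATA])
  case repeek =>
    exact sync _ _ _ (by rw [hc]; exact ⟨rfl, rfl⟩)
      (step_dataTerm_peek.2 ⟨by simp [hc, Pc.queuePc], hq, rfl⟩) (by simp [mem_DATA])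
  case dequeue =>
    exact sync _ _ _ (by rw [hc]; exact ⟨rfl, rfl⟩)
      (step_dataTerm_dequeue.2 ⟨by simp [hc, Pc.queuePc], hq, rfl⟩) (by simp [mem_DATA])
  case peeked v =>
    exact sync _ _ _ (by rw [hc]; exact ⟨_, rfl, rfl⟩)
      (step_dataTerm_ret (v := v).2 ⟨by simp only [hc, Pc.queuePc], hq, rfl⟩) (by simp [mem_DATA])
  case repeeked v =>
    exact sync _ _ _ (by rw [hc]; exact ⟨_, rfl, rfl⟩)
      (step_dataTerm_ret (v := v).2 ⟨by simp only [hc, Pc.queuePc], hq, rfl⟩) (by simp [mem_DATA])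
  case casFree =>
    exact sync _ _ _ (by rw [hc]; exact ⟨_, rfl, rfl⟩)
      (step_dataTerm_casOwner.2 ⟨rfl, rfl⟩) (by simp [mem_DATA])
  case casFrom o =>
    exact sync _ _ _ (by rw [hc]; exact ⟨_, rfl, rfl⟩)
      (step_dataTerm_casOwner.2 ⟨rfl, rfl⟩) (by simp [mem_DATA])
  case recas =>
    exact sync _ _ _ (by rw [hc]; exact ⟨_, rfl, rfl⟩)
      (step_dataTerm_casOwner.2 ⟨rfl, rfl⟩) (by simp [mem_DATA])
  case handOver v =>
    exact sync _ _ _ (by rw [hc]; exact ⟨_, rfl, rfl⟩)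
      (step_dataTerm_casOwner.2 ⟨rfl, rfl⟩) (by simp [mem_DATA])
  case park =>
    exact sync _ _ _ (by rw [hc]; exact ⟨_, rfl, rfl⟩)
      (step_dataTerm_casState.2 ⟨rfl, rfl⟩) (by simp [mem_DATA])
  case schedule r =>
    exact sync _ _ _ (by rw [hc]; exact ⟨_, rfl, rfl⟩)
      (step_dataTerm_casState.2 ⟨rfl, rfl⟩) (by simp [mem_DATA])
  case reschedule r =>
    exact sync _ _ _ (by rw [hc]; exact ⟨_, rfl, rfl⟩)
      (step_dataTerm_casState.2 ⟨rfl, rfl⟩) (by simp [mem_DATA])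

end Step

end State

end ClaimRelease

/-! ## The invariant of the protocol -/

namespace ClaimRelease

variable {N : ℕ}

/-- The phases of a claim/release cycle: not competing for ownership, enqueued but not entitled to
proceed, entitled and still in the queue, dequeued with ownership still to be passed on. -/
inductive Phase : Type
  | outside
  | engaged
  | holding
  | leaving

namespace Pc

/-- The boundaries lie at the atomic actions that matter. A process is `engaged` or `holding` from
the commit of its enqueue to the commit of its dequeue, and `leaving` up to the CAS that gives
ownership away. Scheduling the successor happens after that and counts as `outside`. -/
def phase : Pc N → Phase
  | idle | engage | enqueue | linEnqueue | schedule _ | reschedule _ | scheduled | endRelease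
  | released => .outside
  | endEnqueue | peek | linPeek | peeked _ | casFree | loadOwner | storeOwner | casFrom _ | recas
  | park | await => .engaged
  | activate | yielded | succeed | endClaim | claimed | beginRelease | dequeue
  | linDequeue => .holding
  | dequeued _ | repeek | linRepeek | repeeked _ | handOver _ => .leaving

/-- The process that is about to be scheduled. -/
def scheduling : Pc N → PID N
  | schedule h | reschedule h => some h
  | _ => none

/-- The value that ownership is going to be passed on to. -/
def successor : Pc N → Option (PID N)
  | repeeked v | handOver v => some v
  | _ => none

/-- The process knows that it is at the head of the queue. -/
def sawItself (p : NonNullPID N) : Pc N → Prop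
  | peeked v => v = some p
  | casFree | loadOwner | storeOwner | casFrom _ | recas => True
  | _ => False

/-- The process relies on being scheduled. -/
def waits (p : NonNullPID N) : Pc N → Prop
  | peeked v => v ≠ some p
  | park | await => True
  | _ => False

end Pc

namespace State

/-- `mem_q`, `holding` and `own` tie ownership to the head of the queue; a leaving owner will pass
ownership to NULL or to the current head (NULL may be out of date, if somebody enqueued after the
second peek). `sawItself` persists because only the head dequeues.

The clauses from `scheduling` to `st_await` describe the handshake on the state variables: an
engaged owner has been scheduled or has a unique pending scheduler, and an engaged process that is
SCHEDULED is the owner. `waits` excludes lost wake-ups. The last three clauses record what reads and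
failed CASes have revealed: while `p` is at the head, only `p` takes ownership from NULL, and a
leaving owner can only set NULL or `p`. -/
structure Inv (s : State N) : Prop where
  nodup : s.q.Nodup
  mem_q : ∀ p, p ∈ s.q ↔ (s.pc p).phase = .engaged ∨ (s.pc p).phase = .holding
  holding : ∀ p, (s.pc p).phase = .holding → s.own = some p ∧ s.q.head? = some p
  own : ∀ r, s.own = some r → ((s.pc r).phase = .leaving ∧
      ∀ v, (s.pc r).successor = some v → v = none ∨ v = s.q.head?) ∨
    (((s.pc r).phase = .engaged ∨ (s.pc r).phase = .holding) ∧ s.q.head? = some r)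
  dequeued : ∀ p v, s.pc p = .dequeued v → v = some p
  sawItself : ∀ p, (s.pc p).sawItself p → s.q.head? = some p
  scheduling : ∀ r h, (s.pc r).scheduling = some h →
    s.own = some h ∧ (s.pc h).phase = .engaged ∧ s.st h ≠ .SCHEDULED
  reschedule : ∀ r h, s.pc r = .reschedule h → s.st h = .WAITING
  scheduling_unique : ∀ r r' h h', (s.pc r).scheduling = some h →
    (s.pc r').scheduling = some h' → r = r'
  granted : ∀ p, (s.pc p).phase = .engaged → s.own = some p →
    s.st p = .SCHEDULED ∨ ∃ r, (s.pc r).scheduling = some p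
  scheduled : ∀ p, (s.pc p).phase = .engaged → s.st p = .SCHEDULED → s.own = some p
  st_enqueue : ∀ p, s.pc p = .enqueue ∨ s.pc p = .linEnqueue → s.st p = .ENGAGING
  st_engaged : ∀ p, (s.pc p).phase = .engaged → s.pc p ≠ .await →
    s.st p = .ENGAGING ∨ s.st p = .SCHEDULED
  st_await : ∀ p, s.pc p = .await → s.st p = .WAITING ∨ s.st p = .SCHEDULED
  waits : ∀ p, (s.pc p).waits p → s.q.head? = some p → s.own = some p ∨
    ∃ r, s.own = some r ∧ (s.pc r).phase = .leaving ∧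
      ∀ v, (s.pc r).successor = some v → v = some p
  storeOwner : ∀ p, s.pc p = .storeOwner → s.own = none
  casFrom : ∀ p o, s.pc p = .casFrom o →
    o ≠ p ∧ (s.own = some o ∨ s.own = none ∨ s.own = some p)
  recas : ∀ p, s.pc p = .recas → s.own = none ∨ s.own = some p

theorem inv_init : (init N).Inv := by
  constructor <;> simp [init, Pc.phase, Pc.scheduling, Pc.sawItself, Pc.waits]

/-- Appending to a nonempty queue keeps the head. If the queue was empty, `p` becomes the head
without having peeked, so it does not wait yet; any owner is then leaving, and a successor it has
chosen can only be NULL. -/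
theorem Inv.next_linEnqueue {s s' : State N} (hs : s.Inv) {p : NonNullPID N} {l : Option (Event N)}
    (h : s.next p = some (l, s')) (hc : s.pc p = .linEnqueue) : s'.Inv := by
  obtain ⟨h1, h2, h3, h4, h5, h6, h7, h8, h9, h10, h11, h12, h13, h14, h15, h16, h17, h18⟩ := hs
  simp only [State.next, hc] at h
  cases h
  cases hq : s.q with
  | nil =>
    constructor <;> simp only [goto, Function.update_apply, hq, List.nil_append, List.head?_cons] <;>
    grind [Pc.phase, Pc.scheduling, Pc.successor, Pc.sawItself, Pc.waits]
  | cons a t =>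
    have hp : p ∉ s.q := by rw [h2, hc]; simp [Pc.phase]
    constructor <;> simp only [goto, Function.update_apply, hq, List.cons_append, List.head?_cons] <;>
    grind [Pc.phase, Pc.scheduling, Pc.successor, Pc.sawItself, Pc.waits]

/-- The process is holding, hence owner and head, so it removes itself. It stays owner and has not
chosen a successor, which is what `waits` requires for the new head. -/
theorem Inv.next_linDequeue {s s' : State N} (hs : s.Inv) {p : NonNullPID N} {l : Option (Event N)}
    (h : s.next p = some (l, s')) (hc : s.pc p = .linDequeue) : s'.Inv := by
  obtain ⟨h1, h2, h3, h4, h5, h6, h7, h8, h9, h10, h11, h12, h13, h14, h15, h16, h17, h18⟩ := hs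
  simp only [State.next, hc] at h
  cases h
  obtain ⟨ho, hd⟩ := h3 p (by rw [hc]; rfl)
  obtain ⟨t, hq⟩ : ∃ t, s.q = p :: t := by
    cases hq : s.q <;> simp_all
  constructor <;> simp only [goto, Function.update_apply, hq, List.tail_cons, List.head?_cons] <;>
  grind [Pc.phase, Pc.scheduling, Pc.successor, Pc.sawItself, Pc.waits]

theorem Inv.next_handOver {s s' : State N} (hs : s.Inv) {p : NonNullPID N}
    {l : Option (Event N)} {v : PID N} (h : s.next p = some (l, s')) (hc : s.pc p = .handOver v) :
    s'.Inv := by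
  obtain ⟨h1, h2, h3, h4, h5, h6, h7, h8, h9, h10, h11, h12, h13, h14, h15, h16, h17, h18⟩ := hs
  simp only [State.next, hc] at h
  cases h
  split_ifs with ho
  · have hsucc : (s.pc p).successor = some v := by rw [hc]; rfl
    have hphase : (s.pc p).phase = .leaving := by rw [hc]; rfl
    -- The owner is `p`, so the second alternative of `waits` applies to a waiting head and says
    -- that `v` is that head. In particular, passing ownership to NULL strands nobody.
    have hwaits : ∀ x, (s.pc x).waits x → s.q.head? = some x → v = some x := by
      intro x hx hq
      rcases h15 x hx hq with h | ⟨r, h, -, h'⟩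
      · rw [ho, Option.some.injEq] at h
        subst h
        rw [hc] at hx
        exact hx.elim
      · rw [ho, Option.some.injEq] at h
        subst h
        exact h' v hsucc
    -- A pending scheduler would make the owner engaged, but the owner `p` is leaving. So the
    -- scheduler created by this step is the only one.
    have hsched : ∀ r x, (s.pc r).scheduling ≠ some x := by
      intro r x hr
      obtain ⟨h, h', -⟩ := h7 r x hr
      rw [ho, Option.some.injEq] at h
      subst h
      simp [hphase] at h'
    cases v with
    | none =>
      simp only [Option.elim]
      constructor <;> simp only [State.goto, Function.update_apply] <;>
      grind [Pc.phase, Pc.scheduling, Pc.successor, Pc.sawItself, Pc.waits]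
    | some a =>
      have hq : s.q.head? = some a := by
        rcases h4 p ho with ⟨-, h⟩ | ⟨h, -⟩
        · exact ((h _ hsucc).resolve_left (by simp)).symm
        · simp [hphase] at h
      -- The new owner is in the queue, and it is not holding because a holder would already be the
      -- owner.
      have ha : (s.pc a).phase = .engaged := by
        rcases (h2 a).1 (List.mem_of_mem_head? hq) with h | h
        · exact h
        · have := (h3 a h).1
          rw [ho, Option.some.injEq] at this
          subst this
          simp [hphase] at h
      have hst : s.st a ≠ .SCHEDULED := fun h => by
        have := h11 a ha h
        rw [ho, Option.some.injEq] at this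
        subst this
        simp [hphase] at ha
      have hap : a ≠ p := by rintro rfl; simp [hphase] at ha
      simp only [Option.elim]
      constructor <;> simp only [State.goto, Function.update_apply] <;>
      grind [Pc.phase, Pc.scheduling, Pc.successor, Pc.sawItself, Pc.waits]
  · constructor <;> simp only [State.goto, Function.update_apply] <;>
    grind [Pc.phase, Pc.scheduling, Pc.successor, Pc.sawItself, Pc.waits]

/-! ### The kinds of move that preserve the invariant -/

section Moves

variable {s : State N} {p : NonNullPID N}

/-- A move within a phase that has no effect on the shared data. -/
theorem Inv.of_goto (hs : s.Inv) {c : Pc N}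
    (hphase : c.phase = (s.pc p).phase) (hsched : c.scheduling = none)
    (hp : (s.pc p).scheduling = none)
    (hsucc : c.successor = none ∨ c.successor = (s.pc p).successor ∨
      c.successor = some s.q.head?)
    (hsaw : c.sawItself p → s.q.head? = some p)
    (hwaits : c.waits p → s.q.head? = some p → s.own = some p ∨ (s.pc p).waits p)
    (hdeq : ∀ v, c ≠ .dequeued v) (hawait : c ≠ .await ∧ s.pc p ≠ .await)
    (henq : c = .enqueue ∨ c = .linEnqueue → s.st p = .ENGAGING)
    (hstore : c = .storeOwner → s.own = none)
    (hfrom : ∀ o, c = .casFrom o → o ≠ p ∧ s.own = some o)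
    (hrecas : c = .recas → s.own = none ∨ s.own = some p) : (s.goto p c).Inv := by
  obtain ⟨h1, h2, h3, h4, h5, h6, h7, h8, h9, h10, h11, h12, h13, h14, h15, h16, h17, h18⟩ := hs
  constructor <;> simp only [goto, Function.update_apply] <;>
  grind [Pc.scheduling]

/-- A process at the head of the queue makes itself the owner. -/
theorem Inv.acquire (hs : s.Inv) (hphase : (s.pc p).phase = .engaged)
    (hq : s.q.head? = some p) (ho : s.own ≠ some p) :
    State.Inv { s.goto p .succeed with own := some p } := by
  obtain ⟨h1, h2, h3, h4, h5, h6, h7, h8, h9, h10, h11, h12, h13, h14, h15, h16, h17, h18⟩ := hs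
  -- Any previous owner is leaving, since an owner in the queue would be the head `p`; its hand-over
  -- will simply fail. For the same reason no scheduler is pending: its target would be an engaged
  -- owner, hence `p`.
  constructor <;> simp only [goto, Function.update_apply] <;>
  grind [Pc.phase, Pc.scheduling, Pc.successor, Pc.sawItself, Pc.waits]

/-- A process that was scheduled becomes entitled to proceed. -/
theorem Inv.proceed (hs : s.Inv) {c : Pc N} (hphase : (s.pc p).phase = .engaged)
    (hst : s.st p = .SCHEDULED) (hc : c = .succeed ∨ c = .activate) : (s.goto p c).Inv := by
  obtain ⟨h1, h2, h3, h4, h5, h6, h7, h8, h9, h10, h11, h12, h13, h14, h15, h16, h17, h18⟩ := hs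
  have ho := h11 p hphase hst
  have hq : s.q.head? = some p := by
    rcases h4 p ho with ⟨h, -⟩ | ⟨-, h⟩
    · simp [hphase] at h
    · exact h
  have hphase' : c.phase = .holding := by rcases hc with rfl | rfl <;> rfl
  have hsched : c.scheduling = none := by rcases hc with rfl | rfl <;> rfl
  have hsaw : ¬ c.sawItself p := by rcases hc with rfl | rfl <;> simp [Pc.sawItself]
  have hwaits : ¬ c.waits p := by rcases hc with rfl | rfl <;> simp [Pc.waits]
  constructor <;> simp only [goto, Function.update_apply] <;>
  grind [Pc.scheduling]

/-- The invariant constrains the state variable only of engaged processes and of those at `enqueue`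
or `linEnqueue`. -/
theorem Inv.of_setSt (hs : s.Inv) {v : PState}
    (hphase : (s.pc p).phase = .outside ∨ (s.pc p).phase = .holding)
    (henq : s.pc p ≠ .enqueue ∧ s.pc p ≠ .linEnqueue) : (s.setSt p v).Inv := by
  obtain ⟨h1, h2, h3, h4, h5, h6, h7, h8, h9, h10, h11, h12, h13, h14, h15, h16, h17, h18⟩ := hs
  constructor <;> simp only [setSt, Function.update_apply] <;>
  grind [Pc.phase, Pc.scheduling]

/-- Overwriting the state variable is harmful only if it would erase SCHEDULED. Otherwise a
scheduler that is still pending will find WAITING. -/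
theorem Inv.of_park (hs : s.Inv) (hc : s.pc p = .park) :
    ((s.goto p .await).setSt p .WAITING).Inv ∨ s.st p = .SCHEDULED := by
  refine or_iff_not_imp_right.2 fun hst => ?_
  obtain ⟨h1, h2, h3, h4, h5, h6, h7, h8, h9, h10, h11, h12, h13, h14, h15, h16, h17, h18⟩ := hs
  constructor <;> simp only [goto, setSt, Function.update_apply] <;>
  grind [Pc.phase, Pc.scheduling, Pc.successor, Pc.sawItself, Pc.waits]

/-- Covers both CASes of a scheduler. Its target is the owner, so it may become SCHEDULED, and by
uniqueness no other scheduler remains pending. -/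
theorem Inv.of_schedule (hs : s.Inv) {h : NonNullPID N} (hc : (s.pc p).scheduling = some h) :
    ((s.goto p .scheduled).setSt h .SCHEDULED).Inv := by
  have hphase : (s.pc p).phase = .outside := by
    cases hp : s.pc p <;> simp [hp, Pc.scheduling] at hc <;> rfl
  have henq : s.pc p ≠ .enqueue ∧ s.pc p ≠ .linEnqueue := by
    constructor <;> intro hp <;> simp [hp, Pc.scheduling] at hc
  obtain ⟨h1, h2, h3, h4, h5, h6, h7, h8, h9, h10, h11, h12, h13, h14, h15, h16, h17, h18⟩ := hs
  constructor <;> simp only [goto, setSt, Function.update_apply] <;>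
  grind [Pc.phase, Pc.scheduling, Pc.successor, Pc.sawItself, Pc.waits]

/-- The target is engaged and not SCHEDULED. If it is not ENGAGING either, it has parked and is
WAITING, so the second CAS of the scheduler cannot fail. -/
theorem Inv.of_not_engaging (hs : s.Inv) {h : NonNullPID N} (hc : s.pc p = .schedule h)
    (hst : s.st h ≠ .ENGAGING) : (s.goto p (.reschedule h)).Inv := by
  obtain ⟨h1, h2, h3, h4, h5, h6, h7, h8, h9, h10, h11, h12, h13, h14, h15, h16, h17, h18⟩ := hs
  have hst' : s.st h = .WAITING := by
    obtain ⟨-, ha, hb⟩ := h7 p h (by rw [hc]; rfl)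
    by_cases hw : s.pc h = .await
    · exact (h14 h hw).resolve_right hb
    · exact ((h13 h ha hw).resolve_left hst |> hb).elim
  constructor <;> simp only [goto, Function.update_apply] <;>
  grind [Pc.phase, Pc.scheduling, Pc.successor, Pc.sawItself, Pc.waits]

end Moves

theorem Inv.of_next {s s' : State N} (hs : s.Inv) {p : NonNullPID N} {l : Option (Event N)}
    (h : s.next p = some (l, s')) : s'.Inv := by
  cases hc : s.pc p
  case linEnqueue => exact hs.next_linEnqueue h hc
  case linDequeue => exact hs.next_linDequeue h hc
  case handOver v => exact hs.next_handOver h hc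
  all_goals
    have hsaw := hs.sawItself p
    simp only [hc, Pc.sawItself, true_implies] at hsaw
    simp only [State.next, hc] at h
  case idle | enqueue | endEnqueue | peek | yielded | endClaim | claimed | beginRelease | dequeue
      | repeek | linRepeek | repeeked | scheduled | endRelease | released =>
    cases h
    exact hs.of_goto (by rw [hc]; rfl) rfl (by rw [hc]; rfl) (by rw [hc]; simp [Pc.successor])
      (by simp [Pc.sawItself]) (by simp [Pc.waits]) (by simp) (by simp [hc])
      (by simp [hs.st_enqueue p, hc]) (by simp) (by simp) (by simp)
  case dequeued v =>
    split_ifs at h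
    cases h
    exact hs.of_goto (by rw [hc]; rfl) rfl (by rw [hc]; rfl) (by rw [hc]; simp [Pc.successor])
      (by simp [Pc.sawItself]) (by simp [Pc.waits]) (by simp) (by simp [hc])
      (by simp) (by simp) (by simp) (by simp)
  case linPeek =>
    cases h
    exact hs.of_goto (by rw [hc]; rfl) rfl (by rw [hc]; rfl) (by simp [Pc.successor])
      (by simp [Pc.sawItself]) (by simp +contextual [Pc.waits]) (by simp) (by simp [hc])
      (by simp) (by simp) (by simp) (by simp)
  case peeked v =>
    cases h
    split_ifs with hv
    · exact hs.of_goto (by rw [hc]; rfl) rfl (by rw [hc]; rfl) (by simp [Pc.successor])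
        (fun _ => hsaw hv) (by simp [Pc.waits]) (by simp) (by simp [hc])
        (by simp) (by simp) (by simp) (by simp)
    · exact hs.of_goto (by rw [hc]; rfl) rfl (by rw [hc]; rfl) (by simp [Pc.successor])
        (by simp [Pc.sawItself]) (fun _ _ => .inr (by rw [hc]; exact hv)) (by simp) (by simp [hc])
        (by simp) (by simp) (by simp) (by simp)
  case engage =>
    cases h
    -- The two updates commute; the variable is set first because `st_enqueue` demands ENGAGING on
    -- arrival at `enqueue`.
    have hs' := hs.of_setSt (p := p) (v := .ENGAGING) (by simp [hc, Pc.phase]) (by simp [hc])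
    exact hs'.of_goto (by simp [setSt, hc, Pc.phase]) rfl (by simp [setSt, hc, Pc.scheduling])
      (by simp [Pc.successor]) (by simp [Pc.sawItself]) (by simp [Pc.waits]) (by simp)
      (by simp [setSt, hc]) (by simp [setSt]) (by simp) (by simp) (by simp)
  case casFree =>
    cases h
    split_ifs with ho
    · exact hs.acquire (by rw [hc]; rfl) hsaw (by simp [ho])
    · exact hs.of_goto (by rw [hc]; rfl) rfl (by rw [hc]; rfl) (by simp [Pc.successor])
        (fun _ => hsaw) (by simp [Pc.waits]) (by simp) (by simp [hc])
        (by simp) (by simp) (by simp) (by simp)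
  case loadOwner =>
    cases h
    rcases ho : s.own with _ | o
    · exact hs.of_goto (by rw [hc]; rfl) rfl (by rw [hc]; rfl) (by simp [Pc.successor])
        (fun _ => hsaw) (by simp [Pc.waits]) (by simp) (by simp [hc])
        (by simp) (by simp [ho]) (by simp) (by simp)
    · rcases eq_or_ne o p with rfl | hop
      · simp only [Option.elim, if_true]
        exact hs.of_goto (by rw [hc]; rfl) rfl (by rw [hc]; rfl) (by simp [Pc.successor])
          (fun _ => hsaw) (fun _ _ => .inl ho) (by simp) (by simp [hc])
          (by simp) (by simp) (by simp) (by simp)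
      · simp only [Option.elim, hop, if_false]
        exact hs.of_goto (by rw [hc]; rfl) rfl (by rw [hc]; rfl) (by simp [Pc.successor])
          (fun _ => hsaw) (by simp [Pc.waits]) (by simp) (by simp [hc])
          (by simp) (by simp) (by simp [ho, hop]) (by simp)
  case storeOwner =>
    cases h
    exact hs.acquire (by rw [hc]; rfl) hsaw (by simp [hs.storeOwner p hc])
  case casFrom o =>
    cases h
    obtain ⟨hop, ho'⟩ := hs.casFrom p o hc
    split_ifs with ho
    · exact hs.acquire (by rw [hc]; rfl) hsaw (by simp [ho, hop])
    · exact hs.of_goto (by rw [hc]; rfl) rfl (by rw [hc]; rfl) (by simp [Pc.successor])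
        (fun _ => hsaw) (by simp [Pc.waits]) (by simp) (by simp [hc])
        (by simp) (by simp) (by simp) (fun _ => ho'.resolve_left ho)
  case recas =>
    cases h
    split_ifs with ho
    · exact hs.acquire (by rw [hc]; rfl) hsaw (by simp [ho])
    -- The owner is not NULL, so by `recas` it is `p`: ownership has been handed over meanwhile, and
    -- parking is safe.
    · exact hs.of_goto (by rw [hc]; rfl) rfl (by rw [hc]; rfl) (by simp [Pc.successor])
        (fun _ => hsaw) (fun _ _ => .inl ((hs.recas p hc).resolve_left ho)) (by simp) (by simp [hc])
        (by simp) (by simp) (by simp) (by simp)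
  case park =>
    cases h
    split_ifs with hst
    · exact (hs.of_park hc).resolve_right (by simp [hst])
    · exact hs.proceed (by rw [hc]; rfl)
        ((hs.st_engaged p (by rw [hc]; rfl) (by simp [hc])).resolve_left hst) (.inl rfl)
  case await =>
    split_ifs at h with hst
    cases h
    exact hs.proceed (by rw [hc]; rfl) hst (.inr rfl)
  case activate =>
    cases h
    exact (hs.of_goto (p := p) (c := .yielded) (by rw [hc]; rfl) rfl (by rw [hc]; rfl)
      (by simp [Pc.successor]) (by simp [Pc.sawItself]) (by simp [Pc.waits]) (by simp)
      (by simp [hc]) (by simp) (by simp) (by simp) (by simp)).of_setSt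
      (by simp [goto, Pc.phase]) (by simp [goto])
  case succeed =>
    cases h
    exact (hs.of_goto (p := p) (c := .endClaim) (by rw [hc]; rfl) rfl (by rw [hc]; rfl)
      (by simp [Pc.successor]) (by simp [Pc.sawItself]) (by simp [Pc.waits]) (by simp)
      (by simp [hc]) (by simp) (by simp) (by simp) (by simp)).of_setSt
      (by simp [goto, Pc.phase]) (by simp [goto])
  case schedule r =>
    cases h
    split_ifs with hst
    · exact hs.of_schedule (by rw [hc]; rfl)
    · exact hs.of_not_engaging hc hst
  case reschedule r =>
    cases h
    rw [if_pos (hs.reschedule p r hc)]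
    exact hs.of_schedule (by rw [hc]; rfl)

end State

end ClaimRelease

/-! ## Progress -/

namespace ClaimRelease

open Proc Event

variable {N : ℕ}

namespace Pc

/-- A bound on the number of internal actions up to the next visible event. -/
def rank : Pc N → ℕ
  | idle => 0
  | engage => 2
  | enqueue => 1
  | linEnqueue => 0
  | endEnqueue => 12
  | peek => 11
  | linPeek => 10
  | peeked _ => 9
  | casFree => 8
  | loadOwner => 7
  | storeOwner => 2
  | casFrom _ => 6
  | recas => 5
  | park => 4
  | await => 3
  | activate => 2
  | yielded => 1
  | succeed => 1
  | endClaim => 0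
  | claimed => 14
  | beginRelease => 13
  | dequeue => 12
  | linDequeue => 11
  | dequeued _ => 10
  | repeek => 9
  | linRepeek => 8
  | repeeked _ => 7
  | handOver _ => 6
  | schedule _ => 5
  | reschedule _ => 4
  | scheduled => 3
  | endRelease => 2
  | released => 1

/-- The process has ended its claim but is still in the queue. -/
def past : Pc N → Bool
  | claimed | beginRelease | dequeue | linDequeue => true
  | _ => false

def inClaim : Pc N → Bool
  | engage | enqueue | linEnqueue | endEnqueue | peek | linPeek | peeked _ | casFree | loadOwner
  | storeOwner | casFrom _ | recas | park | await | activate | yielded | succeed | endClaim => true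
  | _ => false

end Pc

namespace State

/-- The processes that are claiming. -/
def claims (s : State N) : Finset (NonNullPID N) := {p | (s.pc p).inClaim = true}

/-- The processes that have enqueued but not ended their claims. -/
def waiting (s : State N) : List (NonNullPID N) := s.q.filter fun p => !(s.pc p).past

theorem mem_claims {s : State N} {p : NonNullPID N} : p ∈ s.claims ↔ (s.pc p).inClaim = true := by
  simp [claims]

theorem mem_waiting {s : State N} {p : NonNullPID N} :
    p ∈ s.waiting ↔ p ∈ s.q ∧ (s.pc p).past = false := by
  simp [waiting]

/-! ### Internal actions: decreasing rank, unchanged oracle state -/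

section Internal

variable {s s' : State N} {p : NonNullPID N}

/-- Collects everything about an internal action that termination and the refinement map depend on.
The commit of a dequeue is the only one that changes the queue. -/
theorem next_internal (h : s.next p = some (none, s')) :
    ∃ c, s'.pc = Function.update s.pc p c ∧ c.inClaim = (s.pc p).inClaim ∧
      c.rank < (s.pc p).rank ∧ ((s'.q = s.q ∧ c.past = (s.pc p).past) ∨
        (s.pc p = .linDequeue ∧ c = .dequeued s.q.head? ∧ s'.q = s.q.tail)) := by
  cases hc : s.pc p <;> simp only [next, hc] at h
  case loadOwner =>
    cases h
    refine ⟨_, rfl, ?_⟩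
    cases s.own with
    | none => exact ⟨rfl, by simp [Pc.rank], .inl ⟨rfl, rfl⟩⟩
    | some o =>
      by_cases h : o = p <;>
      exact ⟨by simp [h, Pc.inClaim], by simp [h, Pc.rank], .inl ⟨rfl, by simp [h, Pc.past]⟩⟩
  case handOver v =>
    cases h
    split_ifs <;> refine ⟨_, rfl, ?_⟩
    · cases v <;> exact ⟨rfl, by simp [Pc.rank], .inl ⟨rfl, rfl⟩⟩
    · exact ⟨rfl, by simp [Pc.rank], .inl ⟨rfl, rfl⟩⟩
  case linDequeue =>
    cases h
    exact ⟨_, rfl, rfl, by simp [Pc.rank], .inr ⟨rfl, rfl, rfl⟩⟩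
  case peeked v =>
    cases h
    exact ⟨_, rfl, by split_ifs <;> rfl, by split_ifs <;> simp [Pc.rank],
      .inl ⟨rfl, by split_ifs <;> rfl⟩⟩
  all_goals
    (try split_ifs at h) <;> cases h <;>
    exact ⟨_, rfl, rfl, by simp [Pc.rank], .inl ⟨rfl, rfl⟩⟩

theorem sum_rank_lt (h : s.next p = some (none, s')) :
    ∑ j, (s'.pc j).rank < ∑ j, (s.pc j).rank := by
  obtain ⟨c, hc, -, hr, -⟩ := next_internal h
  refine Finset.sum_lt_sum (fun j _ => ?_) ⟨p, Finset.mem_univ p, by simpa [hc] using hr⟩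
  rcases eq_or_ne j p with rfl | hj
  · simpa [hc] using hr.le
  · simp [hc, hj]

theorem claims_internal (h : s.next p = some (none, s')) : s'.claims = s.claims := by
  obtain ⟨c, hc, hi, -, -⟩ := next_internal h
  ext j
  rw [mem_claims, mem_claims, hc]
  rcases eq_or_ne j p with rfl | hj
  · simp [hi]
  · simp [hj]

theorem Inv.waiting_internal (hs : s.Inv) (h : s.next p = some (none, s')) :
    s'.waiting = s.waiting := by
  obtain ⟨c, hc, -, -, ⟨hq, hp⟩ | ⟨hpc, rfl, hq⟩⟩ := next_internal h
  · unfold waiting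
    rw [hq, hc]
    congr 1
    funext j
    rcases eq_or_ne j p with rfl | hj
    · simp [hp]
    · simp [hj]
  · obtain ⟨-, hd⟩ := hs.holding p (by rw [hpc]; rfl)
    have hnodup := hs.nodup
    unfold waiting
    rw [hq, hc]
    cases hq' : s.q with
    | nil => simp [hq'] at hd
    | cons a t =>
      obtain rfl : a = p := by simpa [hq'] using hd
      rw [hq', List.nodup_cons] at hnodup
      -- The removed head has already ended its claim, so the filter had dropped it; as it occurs
      -- only once, its new control point does not affect the rest.
      rw [List.tail_cons, List.filter_cons_of_neg (by simp [hpc, Pc.past])]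
      refine List.filter_congr fun j hj => ?_
      have : j ≠ a := by rintro rfl; exact hnodup.1 hj
      simp [this]

end Internal

/-- The oracle in the state `s`. -/
def oracle (s : State N) : CProc N := call (.fair s.claims s.waiting)

theorem oracle_init : (init N).oracle = FAIR N := by
  simp [oracle, FAIR, claims, waiting, init, Pc.inClaim]

end State

theorem step_fair {max : ℕ} {C : Finset (NonNullPID N)} {w : List (NonNullPID N)}
    {a : Act (Event N)} {R : CProc N} :
    Step (procDefs N max) (call (.fair C w)) a R ↔
      (∃ p ∉ C, a = .ev (beginClaim p) ∧ R = call (.fair (C ∪ {p}) w)) ∨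
      (∃ p, (p ∈ C ∧ p ∉ w) ∧ a = .ev (linEnqueue p p) ∧ R = call (.fair C (w ++ [p]))) ∨
      ∃ p t, w = p :: t ∧ a = .ev (endClaim p) ∧ R = call (.fair (C \ {p}) t) := by
  rw [step_call]
  show Step _ (fairBody C w) a R ↔ _
  unfold fairBody
  cases w with
  | nil =>
    rw [step_ext_of_stable (by simp [step_inputFrom])
      (by simp [step_ext_tau, step_inputFrom, step_STOP]),
      step_ext_of_stable (by simp [step_inputFrom]) (by simp [step_STOP])]
    simp [step_inputFrom, step_STOP]
  | cons h t =>
    rw [step_ext_of_stable (by simp [step_inputFrom])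
      (by simp [step_ext_tau, step_inputFrom, step_pre]),
      step_ext_of_stable (by simp [step_inputFrom]) (by simp [step_pre])]
    simp only [step_inputFrom, step_pre, Set.mem_ofPred_eq, List.cons.injEq]
    refine or_congr Iff.rfl (or_congr Iff.rfl ⟨fun h' => ⟨h, t, ⟨rfl, rfl⟩, h'⟩, ?_⟩)
    rintro ⟨_, _, ⟨rfl, rfl⟩, h'⟩
    exact h'

namespace State

/-! ### Visible events are steps of the oracle -/

section Oracle

variable {max : ℕ} {s s' : State N} {p : NonNullPID N}

theorem next_visible {e : Event N} (h : s.next p = some (some e, s')) :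
    (s.pc p = .idle ∧ e = beginClaim p ∧ s' = s.goto p .engage) ∨
    (s.pc p = .linEnqueue ∧ e = linEnqueue p p ∧
      s' = { s.goto p .endEnqueue with q := s.q ++ [p] }) ∨
    (s.pc p = .endClaim ∧ e = endClaim p ∧ s' = s.goto p .claimed) := by
  cases hc : s.pc p <;> simp only [next, hc] at h
  case idle => cases h; simp
  case linEnqueue => cases h; simp
  case endClaim => cases h; simp
  all_goals (try split_ifs at h) <;> cases h

theorem waiting_goto_of_not_mem {c : Pc N} (h : p ∉ s.q) : (s.goto p c).waiting = s.waiting := by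
  refine List.filter_congr fun j hj => ?_
  have : j ≠ p := by rintro rfl; exact h hj
  simp [goto, this]

theorem Inv.step_oracle (hs : s.Inv) {e : Event N} (h : s.next p = some (some e, s')) :
    Step (procDefs N max) s.oracle (.ev e) s'.oracle := by
  unfold oracle
  rw [step_fair]
  rcases next_visible h with ⟨hc, rfl, rfl⟩ | ⟨hc, rfl, rfl⟩ | ⟨hc, rfl, rfl⟩
  · have hq : p ∉ s.q := by rw [hs.mem_q, hc]; simp [Pc.phase]
    refine .inl ⟨p, by simp [mem_claims, hc, Pc.inClaim], rfl, ?_⟩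
    rw [waiting_goto_of_not_mem hq]
    congr 2
    ext j
    rcases eq_or_ne j p with rfl | hj
    · simp [mem_claims, goto, Pc.inClaim]
    · simp [mem_claims, goto, hj]
  · have hq : p ∉ s.q := by rw [hs.mem_q, hc]; simp [Pc.phase]
    refine .inr (.inl ⟨p, ⟨by simp [mem_claims, hc, Pc.inClaim],
      fun h => hq (mem_waiting.1 h).1⟩, rfl, ?_⟩)
    have hw : waiting { s.goto p .endEnqueue with q := s.q ++ [p] } = s.waiting ++ [p] := by
      rw [← waiting_goto_of_not_mem (c := .endEnqueue) hq]
      simp [waiting, goto, Pc.past]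
    rw [hw]
    congr 2
    ext j
    rcases eq_or_ne j p with rfl | hj
    · simp [mem_claims, goto, Pc.inClaim, hc]
    · simp [mem_claims, goto, hj]
  -- Ending a claim is possible only for a holder, which is the head of the queue and not yet past
  -- its claim, hence the head of `waiting`.
  · obtain ⟨-, hd⟩ := hs.holding p (by rw [hc]; rfl)
    have hnodup := hs.nodup
    cases hq : s.q with
    | nil => simp [hq] at hd
    | cons a t =>
      obtain rfl : a = p := by simpa [hq] using hd
      rw [hq, List.nodup_cons] at hnodup
      refine .inr (.inr ⟨a, (s.goto a .claimed).waiting, ?_, rfl, ?_⟩)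
      · simp only [waiting, goto, hq]
        rw [List.filter_cons_of_pos (by simp [hc, Pc.past]),
          List.filter_cons_of_neg (by simp [Pc.past])]
        congr 1
        refine List.filter_congr fun j hj => ?_
        have : j ≠ a := by rintro rfl; exact hnodup.1 hj
        simp [this]
      · congr 2
        ext j
        rcases eq_or_ne j a with rfl | hj
        · simp [mem_claims, goto, Pc.inClaim]
        · simp [mem_claims, goto, hj]

end Oracle

/-- The control points at which a process has no internal action. -/
theorem Inv.pc_of_stable {s : State N} (hs : s.Inv) {p : NonNullPID N}
    (h : ∀ s', s.next p ≠ some (none, s')) :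
    s.pc p = .idle ∨ s.pc p = .linEnqueue ∨ s.pc p = .endClaim ∨
      (s.pc p = .await ∧ s.st p ≠ .SCHEDULED) := by
  cases hc : s.pc p <;> simp only [next, hc] at h
  case idle => simp
  case linEnqueue => simp
  case endClaim => simp
  case await =>
    refine .inr (.inr (.inr ⟨rfl, fun hst => ?_⟩))
    rw [if_pos hst] at h
    exact h _ rfl
  case dequeued v =>
    -- The user accepts only its own identifier; by the invariant that is what was dequeued, so it
    -- is not blocked.
    rw [if_pos (hs.dequeued p v hc)] at h
    exact (h _ rfl).elim
  all_goals exact (h _ rfl).elim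

/-- In a stable state the first process of the queue is about to end its claim. -/
theorem Inv.endClaim_of_stable {s : State N} (hs : s.Inv)
    (h : ∀ p s', s.next p ≠ some (none, s')) {p : NonNullPID N} (hp : s.q.head? = some p) :
    s.pc p = .endClaim := by
  have hst := fun p => hs.pc_of_stable (h p)
  have hq := (hs.mem_q p).1 (List.mem_of_mem_head? hp)
  rcases hst p with hc | hc | hc | ⟨hc, hS⟩
  · simp [hc, Pc.phase] at hq
  · simp [hc, Pc.phase] at hq
  · exact hc
  -- A head parked without being scheduled needs either a pending scheduler or a leaving owner. Both
  -- have internal actions, which a stable state excludes.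
  · exfalso
    rcases hs.waits p (by rw [hc]; trivial) hp with ho | ⟨r, -, hr, -⟩
    · rcases hs.granted p (by rw [hc]; rfl) ho with h' | ⟨r, hr⟩
      · exact hS h'
      · rcases hst r with h' | h' | h' | ⟨h', -⟩ <;> simp [h', Pc.scheduling] at hr
    · rcases hst r with h' | h' | h' | ⟨h', -⟩ <;> simp [h', Pc.phase] at hr

/-- Since no process is queued twice, the guard of the queue never blocks when the bound is at least
`N`. -/
theorem Inv.length_le {s : State N} (hs : s.Inv) : s.q.length ≤ N := by
  simpa using hs.nodup.length_le_card

/-- Everything that the oracle offers is offered by a stable state of the implementation. -/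
theorem Inv.offers {max : ℕ} [NeZero N] (hmax : N ≤ max) {s : State N} (hs : s.Inv)
    (h : ∀ p s', s.next p ≠ some (none, s')) {a : Act (Event N)} {R : CProc N}
    (ha : Step (procDefs N max) s.oracle a R) : ∃ R', Step (procDefs N max) s.term a R' := by
  have hst := fun p => hs.pc_of_stable (h p)
  have hq := hs.length_le.trans hmax
  rcases step_fair.1 ha with ⟨p, hp, rfl, -⟩ | ⟨p, ⟨hp, hw⟩, rfl, -⟩ | ⟨p, t, hw, rfl, -⟩
  · rw [mem_claims] at hp
    rcases hst p with hc | hc | hc | ⟨hc, -⟩ <;> simp [hc, Pc.inClaim] at hp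
    exact step_of_next (p := p) (l := some (beginClaim p)) hq (by simp only [next, hc]; rfl)
  · rw [mem_claims] at hp
    rw [mem_waiting, hs.mem_q] at hw
    rcases hst p with hc | hc | hc | ⟨hc, -⟩ <;>
      simp [hc, Pc.inClaim, Pc.past, Pc.phase] at hp hw
    exact step_of_next (p := p) (l := some (linEnqueue p p)) hq (by simp only [next, hc]; rfl)
  -- In a stable state nobody is between the end of its claim and its dequeue.
  · have hfilter : s.waiting = s.q := by
      refine List.filter_eq_self.2 fun j _ => ?_
      rcases hst j with hc | hc | hc | ⟨hc, -⟩ <;> simp [hc, Pc.past]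
    have hc := hs.endClaim_of_stable h (p := p) (by rw [← hfilter, hw]; rfl)
    exact step_of_next (p := p) (l := some (endClaim p)) hq (by simp only [next, hc]; rfl)

/-- Induction on the sum of the ranks; the invariant is not needed. -/
theorem not_diverges {max : ℕ} [NeZero N] (s : State N) :
    ¬ Diverges (procDefs N max) s.term := by
  induction hn : ∑ j, (s.pc j).rank using Nat.strong_induction_on generalizing s with
  | _ n ih =>
    rintro ⟨f, h0, hf⟩
    have h1 := hf 0
    rw [h0] at h1
    obtain ⟨p, l, s', hl, ha, hR⟩ := exists_next_of_step h1
    cases l with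
    | some e => cases ha
    | none =>
      exact ih _ (hn ▸ sum_rank_lt hl) s' rfl ⟨fun i => f (i + 1), hR, fun i => hf (i + 1)⟩

/-- Every run of the implementation is matched by the oracle. -/
theorem Inv.reach {max : ℕ} [NeZero N] {s : State N} (hs : s.Inv) {t : List (Obs (Event N))}
    {Q : CProc N} (h : Reach (procDefs N max) s.term t Q) :
    ∃ s' : State N, s'.Inv ∧ Q = s'.term ∧ Reach (procDefs N max) s.oracle t s'.oracle := by
  generalize hP : s.term = P at h
  induction h generalizing s with
  | refl P => exact ⟨s, hs, hP.symm, .refl _⟩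
  | tau hstep _ ih =>
    subst hP
    obtain ⟨p, l, s', hl, ha, rfl⟩ := exists_next_of_step hstep
    cases l with
    | some e => cases ha
    | none =>
      obtain ⟨s'', h1, h2, h3⟩ := ih (hs.of_next hl) rfl
      refine ⟨s'', h1, h2, ?_⟩
      rwa [oracle, claims_internal hl, hs.waiting_internal hl] at h3
  | vis hstep _ ih =>
    subst hP
    obtain ⟨p, l, s', hl, ha, rfl⟩ := exists_next_of_step hstep
    cases l with
    | none => cases ha
    | some e =>
      cases ha
      obtain ⟨s'', h1, h2, h3⟩ := ih (hs.of_next hl) rfl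
      exact ⟨s'', h1, h2, .vis (hs.step_oracle hl) h3⟩

end State

/-! ## The orders of events in the traces of the oracle -/

/-- For the induction the oracle starts in an arbitrary state, whose waiting processes count as
enqueued before the trace begins. -/
theorem endOrder_prefix {max : ℕ} {C : Finset (NonNullPID N)} {w : List (NonNullPID N)}
    {t : List (Obs (Event N))} {Q : CProc N}
    (h : Reach (procDefs N max) (call (.fair C w)) t Q) :
    endOrder t <+: w ++ enqueueOrder t := by
  generalize hP : (call (.fair C w) : CProc N) = P at h
  induction h generalizing C w with
  | refl P => simp [endOrder]
  | tau hstep _ ih => subst hP; simp [step_fair] at hstep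
  | @vis _ _ _ _ t hstep _ ih =>
    subst hP
    rcases step_fair.1 hstep with ⟨p, hp, ha, rfl⟩ | ⟨p, hp, ha, rfl⟩ | ⟨p, t, rfl, ha, rfl⟩ <;>
      cases ha
    · exact ih rfl
    · have := ih rfl
      rwa [List.append_assoc] at this
    · exact List.cons_prefix_cons.2 ⟨rfl, ih rfl⟩

/-- For an arbitrary starting state the balance needs a correction: a claim of `p` begun earlier but
not yet enqueued counts as one more `beginClaim`. The assumption that waiting processes are claiming
ensures that a new claim starts outside the queue. -/
theorem count_beginOrder {max : ℕ} {C : Finset (NonNullPID N)} {w : List (NonNullPID N)}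
    (hnodup : w.Nodup) (hsub : ∀ p ∈ w, p ∈ C) {t : List (Obs (Event N))} {Q : CProc N}
    (h : Reach (procDefs N max) (call (.fair C w)) t Q) {s u : List (Obs (Event N))}
    {p v : NonNullPID N} (ht : t = s ++ .ev (linEnqueue p v) :: u) :
    v = p ∧ (beginOrder s).count p + (if p ∈ C ∧ p ∉ w then 1 else 0) =
      (enqueueOrder s).count p + 1 := by
  generalize hP : (call (.fair C w) : CProc N) = P at h
  induction h generalizing C w s with
  | refl P => simp at ht
  | tau hstep _ ih => subst hP; simp [step_fair] at hstep
  | @vis _ _ _ _ t hstep _ ih =>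
    subst hP
    cases s with
    | nil =>
      simp only [List.nil_append, List.cons.injEq] at ht
      obtain ⟨rfl, -⟩ := ht
      rcases step_fair.1 hstep with ⟨p', hp, ha, -⟩ | ⟨p', hp, ha, -⟩ | ⟨p', t, -, ha, -⟩ <;>
        cases ha
      simp [hp, beginOrder, enqueueOrder]
    | cons o s =>
      simp only [List.cons_append, List.cons.injEq] at ht
      obtain ⟨rfl, ht⟩ := ht
      rcases step_fair.1 hstep with ⟨a, hp, ha, rfl⟩ | ⟨a, hp, ha, rfl⟩ | ⟨a, t, rfl, ha, rfl⟩ <;>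
        cases ha
      · obtain ⟨hv, hc⟩ := ih hnodup (fun x hx => by simp [hsub x hx]) ht rfl
        refine ⟨hv, ?_⟩
        have h1 : beginOrder (Obs.ev (beginClaim a) :: s) = a :: beginOrder s := rfl
        have h2 : enqueueOrder (Obs.ev (beginClaim a) :: s) = enqueueOrder s := rfl
        rw [h1, h2, List.count_cons]
        have ha : a ∉ w := fun h => hp (hsub a h)
        by_cases hpa : p = a
        · subst hpa
          simp [ha, hp] at hc ⊢
          omega
        · simp [hpa, Ne.symm hpa] at hc ⊢
          omega
      · obtain ⟨hv, hc⟩ := ih (by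
            rw [List.nodup_append]; simp [hnodup]; rintro x hx rfl; exact hp.2 hx)
          (fun x hx => by
            rcases List.mem_append.1 hx with hx | hx
            · exact hsub x hx
            · simp at hx; exact hx ▸ hp.1) ht rfl
        refine ⟨hv, ?_⟩
        have h1 : beginOrder (Obs.ev (linEnqueue a a) :: s) = beginOrder s := rfl
        have h2 : enqueueOrder (Obs.ev (linEnqueue a a) :: s) = a :: enqueueOrder s := rfl
        rw [h1, h2, List.count_cons]
        by_cases hpa : p = a
        · subst hpa
          simp [hp] at hc ⊢
          omega
        · simp [hpa, Ne.symm hpa] at hc ⊢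
          omega
      · rw [List.nodup_cons] at hnodup
        obtain ⟨hv, hc⟩ := ih hnodup.2 (fun x hx => by
          have : x ≠ a := by rintro rfl; exact hnodup.1 hx
          simp [this, hsub x (List.mem_cons_of_mem _ hx)]) ht rfl
        refine ⟨hv, ?_⟩
        have h1 : beginOrder (Obs.ev (endClaim a) :: s) = beginOrder s := rfl
        have h2 : enqueueOrder (Obs.ev (endClaim a) :: s) = enqueueOrder s := rfl
        rw [h1, h2]
        by_cases hpa : p = a
        · subst hpa
          simpa using hc
        · simpa [hpa] using hc

end ClaimRelease

/-! ### The main theorem -/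

theorem mainTheorem5 (N max : ℕ) (hN : 1 ≤ N) (hN4 : N ≤ 4) (hmax : N ≤ max) :
    FDRefines (ClaimRelease.procDefs N max) (ClaimRelease.FAIR N) (ClaimRelease.FAIR_IMPL N) ∧
    ∀ t ∈ traces (ClaimRelease.procDefs N max) (ClaimRelease.FAIR_IMPL N),
      ClaimRelease.endOrder t <+: ClaimRelease.enqueueOrder t ∧
      ∀ (s u : List (Obs (Event N))) (p v : NonNullPID N),
        t = s ++ Obs.ev (Event.linEnqueue p v) :: u →
          v = p ∧ (ClaimRelease.beginOrder s).count p =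
            (ClaimRelease.enqueueOrder s).count p + 1 := by
  have : NeZero N := ⟨by omega⟩
  have hreach : ∀ {t Q}, Reach (ClaimRelease.procDefs N max) (ClaimRelease.FAIR_IMPL N) t Q →
      ∃ s : ClaimRelease.State N, s.Inv ∧ Q = s.term ∧
        Reach (ClaimRelease.procDefs N max) (ClaimRelease.FAIR N) t s.oracle := fun h => by
    rw [← ClaimRelease.State.oracle_init]
    rw [← ClaimRelease.State.term_init] at h
    exact ClaimRelease.State.inv_init.reach h
  have hdiv : divergences (ClaimRelease.procDefs N max) (ClaimRelease.FAIR_IMPL N) = ∅ := by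
    refine Set.eq_empty_of_forall_notMem ?_
    rintro u ⟨s, t, Q, -, -, hQ, hd⟩
    obtain ⟨s', -, rfl, -⟩ := hreach hQ
    exact s'.not_diverges hd
  refine ⟨⟨?_, by simp [hdiv]⟩, ?_⟩
  · rintro ⟨t, X⟩ (⟨Q, hQ, hX⟩ | hd)
    · obtain ⟨s, hs, rfl, ho⟩ := hreach hQ
      refine .inl ⟨s.oracle, ho, ?_⟩
      rcases hX with ⟨htau, -, hX⟩ | ⟨⟨P', hP'⟩, -⟩
      -- Stability of the CSP term gives stability for `next`, because the queue is within its
      -- bound; `Inv.offers` then turns refusals of the implementation into refusals of the oracle.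
      · have hstable : ∀ p s', s.next p ≠ some (none, s') := fun p s' h => by
          obtain ⟨R, hR⟩ := ClaimRelease.State.step_of_next (hs.length_le.trans hmax) h
          exact htau R hR
        refine .inl ⟨?_, ?_, fun o hoX P' h => ?_⟩
        · simp [ClaimRelease.State.oracle, ClaimRelease.step_fair]
        · simp [ClaimRelease.State.oracle, ClaimRelease.step_fair]
        · obtain ⟨R', hR'⟩ := hs.offers hmax hstable h
          exact hX o hoX R' hR'
      -- The implementation never terminates, so it has no refusals of the second kind.
      · obtain ⟨p, l, s', -, ha, -⟩ := ClaimRelease.State.exists_next_of_step hP'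
        cases l <;> cases ha
    · rw [Set.mem_ofPred_eq, hdiv] at hd
      exact hd.elim
  · rintro t ⟨Q, hQ⟩
    obtain ⟨s, -, -, ho⟩ := hreach hQ
    refine ⟨by simpa using ClaimRelease.endOrder_prefix ho, fun s' u p v ht => ?_⟩
    simpa using ClaimRelease.count_beginOrder List.nodup_nil (by simp) ho ht
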